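/- Let $N\ge 1$. A \emph{state} of the tropical periodic Toda lattice is a family $A=(A_j)_{j\in\mathbb Z/2N\mathbb Z}$ of positive reals with $\sum_{l=1}^N A_{2l}<\sum_{l=1}^N A_{2l-1}$. One step of the time evolution sends $A$ to $\bar A$, where $$\bar A_{2n}=\min\Bigl(A_{2n+1},\,A_{2n}-\min_{0\le k\le N-1}\sum_{l=1}^k\bigl(A_{2(n-l)+1}-A_{2(n-l)}\bigr)\Bigr),\qquad \bar A_{2n+1}=A_{2n+1}+A_{2n+2}-\bar A_{2n}.$$ Put $H_0=0$ and, for $1\le k\le N$, let $H_k=H_k(A)$ be the minimum of $A_{i_1}+\dots+A_{i_k}$ over all $1\le i_1<\dots<i_k\le 2N$ with $i_j+1<i_{j+1}$ for all $j$ and $(i_1,i_k)\ne(1,2N)$. Let $\lambda=\lambda(A)$ be the diagram of $N$ left-justified rows of height $1$ whose lengths, from bottom to top, are $H_1-H_0,\,H_2-H_1,\dots,H_N-H_{N-1}$. A sequence $x_1,\dots,x_{2n}$ satisfies the \emph{highest weight condition} if $\sum_{i=1}^k(x_{2i-1}-x_{2i})\ge 0$ for $1\le k\le n$. For a state $A$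 such that $A_1,\dots,A_{2N}$ satisfies it, define a diagram $\tilde\lambda(A)$ as follows. Start with $x^{(1)}=(A_1,\dots,A_{2N})$ and $N^{(1)}=N$. Given $x^{(i)}$, of length $2N^{(i)}>0$, let $\mu^{(i)}$ be its smallest element and let $y^{(i)}$ arise by subtracting $\mu^{(i)}$ from every element. Let $n_1,n_2,\dots$ be the lengths of the maximal runs of consecutive zeros in the (linear) array $y^{(i)}$, and put $N^{(i+1)}=N^{(i)}-\sum_j\lceil n_j/2\rceil$ and $\nu^{(i)}=N^{(i)}-N^{(i+1)}$. Stop if $N^{(i+1)}=0$. Otherwise obtain $x^{(i+1)}$ from $y^{(i)}$ thus: (1) remove the zeros at the left end; (2) for each run of zeros between positive neighbours $a,b$, remove the zeros if their number is even, and replace $a,0,\dots,0,b$ by the single element $a+b$ if it is odd; (3) remove the zeros at the right end, and if their number is odd, remove also the last remaining element and add it to the first element of the array. The diagram $\tilde\lambda(A)$ has, from bottom to top, $\nu^{(1)}$ rows of length $\mu^{(1)}$, then $\nu^{(2)}$ rows of length $\mu^{(1)}+\mu^{(2)}$, and so on. \textbf{Theorem.} Let $A$ be a state. Some cyclic shift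 $(A_{j+2n})_j$ of $A$ satisfies the highest weight condition. For every such shift, with $\tilde\lambda$ the diagram obtained from it: (a) for every $1\le k\le N$, the area of the part of $\tilde\lambda$ between its bottom line and the horizontal line at height $k$ equals $H_k(A)$; (b) $\tilde\lambda=\lambda(A)$; in particular the row lengths of $\lambda(A)$ are positive and weakly increasing from bottom to top; (c) $\tilde\lambda$ is preserved under the time evolution: for every $t\ge 0$ the family $A^{t}$ obtained from $A$ by $t$ steps of the evolution is again a state, has a cyclic shift by an even number that satisfies the highest weight condition, and the diagram obtained from any such shift of $A^{t}$ equals $\tilde\lambda$. -/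

import Mathlib

noncomputable section

namespace TropToda

/-! ### States, evolution and conserved quantities

A configuration is a family `A : ZMod (2 * N) → ℝ`; odd indices are the white segments and even
indices the black segments (the parity of an index is well defined because `2 * N` is even). -/

/-- The states of the tropical periodic Toda lattice: positive variables in the phase space
`∑ A_{2l} < ∑ A_{2l-1}`. -/
structure IsState (N : ℕ) (A : ZMod (2 * N) → ℝ) : Prop where
  pos : ∀ j, 0 < A j
  phase : ∑ l ∈ Finset.Icc 1 N, A (2 * (l : ZMod (2 * N)))
    < ∑ l ∈ Finset.Icc 1 N, A (2 * (l : ZMod (2 * N)) - 1)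

/-- The new value at the even index `j = 2n`:
`min (A_{2n+1}, A_{2n} - min_{0 ≤ k ≤ N-1} ∑_{l=1}^k (A_{2(n-l)+1} - A_{2(n-l)}))`. -/
def evolveEven (N : ℕ) (A : ZMod (2 * N) → ℝ) (j : ZMod (2 * N)) : ℝ :=
  min (A (j + 1))
    (A j - (Finset.Icc 0 (N - 1)).inf' ⟨0, by simp⟩ (fun k =>
      ∑ l ∈ Finset.Icc 1 k,
        (A (j - 2 * (l : ZMod (2 * N)) + 1) - A (j - 2 * (l : ZMod (2 * N))))))

/-- One step of the time evolution; at the odd index `j = 2n+1` the new value is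
`A_{2n+1} + A_{2n+2}` minus the new value at `2n`. -/
def evolve (N : ℕ) (A : ZMod (2 * N) → ℝ) : ZMod (2 * N) → ℝ := fun j =>
  if Even j.val then evolveEven N A j else A j + A (j + 1) - evolveEven N A (j - 1)

/-- The index sets `{i_1, …, i_k}` with `1 ≤ i_1`, `i_j + 1 < i_{j+1}`, `i_k ≤ 2N` and
`(i_1, i_k) ≠ (1, 2N)`. -/
def exclSets (N k : ℕ) : Finset (Finset ℕ) :=
  {S ∈ Finset.powersetCard k (Finset.Icc 1 (2 * N)) |
    (∀ i ∈ S, i + 1 ∉ S) ∧ ¬ (1 ∈ S ∧ 2 * N ∈ S)}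

/-- The conserved quantity `H_k`: the minimum of `A_{i_1} + ⋯ + A_{i_k}` over `exclSets N k`
(which is nonempty for `k ≤ N`); in particular `H_0 = 0`. -/
def consH (N : ℕ) (A : ZMod (2 * N) → ℝ) (k : ℕ) : ℝ :=
  if h : (exclSets N k).Nonempty then
    (exclSets N k).inf' h (fun S => ∑ i ∈ S, A (i : ZMod (2 * N)))
  else 0

/-! ### Young diagrams with real row lengths

A diagram is given by its row lengths, listed from the bottom row to the top row; every row has
height one. -/

/-- The region of the plane occupied by a diagram: its `j`-th row (counted from the bottom,
starting with `0`) is at heights between `j` and `j + 1`. -/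
def region (rows : List ℝ) : Set (ℝ × ℝ) :=
  {p | ∃ (j : ℕ) (h : j < rows.length),
    p.1 ∈ Set.Icc 0 (rows[j]'h) ∧ p.2 ∈ Set.Ico (j : ℝ) ((j : ℝ) + 1)}

/-- The area of the part of the diagram between its bottom line and the horizontal line at
height `k`. -/
def areaBelow (rows : List ℝ) (k : ℕ) : ENNReal :=
  MeasureTheory.volume (region rows ∩ {p | p.2 < (k : ℝ)})

/-- The diagram of the conserved quantities: from bottom to top, its `N` rows have the lengths
`H_1 - H_0, H_2 - H_1, …, H_N - H_{N-1}`. -/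
def laxRows (N : ℕ) (A : ZMod (2 * N) → ℝ) : List ℝ :=
  (List.range N).map fun j => consH N A (j + 1) - consH N A j

/-! ### The elimination algorithm -/

/-- Cyclic shift of the indices by `2n`. -/
def shift (N : ℕ) (n : ZMod (2 * N)) (A : ZMod (2 * N) → ℝ) : ZMod (2 * N) → ℝ :=
  fun j => A (j + 2 * n)

/-- The highest weight condition for the sequence `A_1, …, A_{2N}`. -/
def HighestWeight (N : ℕ) (A : ZMod (2 * N) → ℝ) : Prop :=
  ∀ k ∈ Finset.Icc 1 N,
    0 ≤ ∑ i ∈ Finset.Icc 1 k, (A (2 * (i : ZMod (2 * N)) - 1) - A (2 * (i : ZMod (2 * N))))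

/-- The sequence `A_1, …, A_{2N}`. -/
def toArray (N : ℕ) (A : ZMod (2 * N) → ℝ) : List ℝ :=
  (List.range (2 * N)).map fun i => A ((i + 1 : ℕ) : ZMod (2 * N))

/-- The smallest element of an array (`0` for the empty array). -/
def arrMin (x : List ℝ) : ℝ := x.minimum.untopD 0

/-- Subtract the smallest element from every element. -/
def subMin (x : List ℝ) : List ℝ := x.map fun a => a - arrMin x

/-- The lengths of the maximal sequences of consecutive zeros, from left to right. -/
def zeroRuns : List ℝ → List ℕ
  | [] => []
  | a :: t =>
    if a = 0 then
      (1 + (t.takeWhile fun b => b = 0).length) :: zeroRuns (t.dropWhile fun b => b = 0)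
    else zeroRuns t
termination_by l => l.length
decreasing_by
  · exact Nat.lt_succ_of_le (List.length_dropWhile_le _ _)
  · simp

/-- `∑_j ⌈n_j / 2⌉` over the lengths `n_j` of the maximal sequences of zeros. -/
def halfZeros (y : List ℝ) : ℕ := ((zeroRuns y).map fun n => (n + 1) / 2).sum

/-- First rule: remove the zeros at the left end. -/
def dropLeft (y : List ℝ) : List ℝ := y.dropWhile fun b => b = 0

/-- Second rule, for an array without zeros at the left end: in `…, a, 0, …, 0, b, …`
with `a, b` nonzero, remove the zeros if their number is even, and replace `a, 0, …, 0, b` by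
`a + b` if it is odd. Zeros at the right end are kept. -/
def mergeInner : List ℝ → List ℝ
  | [] => []
  | a :: t =>
    match _h : t.dropWhile fun b => b = 0 with
    | [] => a :: t
    | b :: r =>
      if Even (t.takeWhile fun b => b = 0).length then a :: mergeInner (b :: r)
      else mergeInner ((a + b) :: r)
termination_by l => l.length
decreasing_by
  all_goals
    have h1 := List.length_dropWhile_le (fun b : ℝ => decide (b = 0)) t
    rw [_h] at h1
    simp only [List.length_cons] at h1 ⊢
    omega

/-- Third rule: remove the zeros at the right end; if their number is odd, remove also the last
remaining element and add it to the first element. -/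
def dropRight (y : List ℝ) : List ℝ :=
  let z := y.rdropWhile fun b => b = 0
  if Even (y.rtakeWhile fun b => b = 0).length then z
  else z.dropLast.modifyHead fun a => a + z.getLastD 0

/-- The passage from `x^{(i)}` to `x^{(i+1)}`. -/
def nextArray (x : List ℝ) : List ℝ := dropRight (mergeInner (dropLeft (subMin x)))

/-- The pairs `(μ^{(i)}, ν^{(i)})` produced by the algorithm from an array `x` of length `2N`,
where `μ^{(i)}` is the smallest element of the current array, `ν^{(i)} = N^{(i)} - N^{(i+1)}`, and
the algorithm stops as soon as `N^{(i)} = 0`. (For a nonempty array the smallest element yields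
at least one zero, so that the second condition in the test is automatic; it is there to make
the recursion well founded.) -/
def blocks (N : ℕ) (x : List ℝ) : List (ℝ × ℕ) :=
  if _h : 0 < N ∧ 0 < halfZeros (subMin x) then
    (arrMin x, N - (N - halfZeros (subMin x))) :: blocks (N - halfZeros (subMin x)) (nextArray x)
  else []
termination_by N

/-- The rows, from bottom to top, of the diagram with the given pairs `(μ^{(i)}, ν^{(i)})` placed
to the right of a strip of width `w`: there are `ν^{(i)}` rows of length
`w + μ^{(1)} + ⋯ + μ^{(i)}`. -/
def rowsFrom : ℝ → List (ℝ × ℕ) → List ℝ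
  | _, [] => []
  | w, (m, v) :: bs => List.replicate v (w + m) ++ rowsFrom (w + m) bs

/-- The Young diagram produced by the elimination algorithm from `A_1, …, A_{2N}`. -/
def elimRows (N : ℕ) (A : ZMod (2 * N) → ℝ) : List ℝ := rowsFrom 0 (blocks N (toArray N A))

end TropToda

end

namespace TropToda

/-! ### Selections of pairwise non-adjacent entries -/

/-! The quantity `consH N A k` is the minimal weight of `k` cyclically non-adjacent entries of the
array (`CycSel`, `consH_eq`), and the elimination is a way of computing this minimum. Subtracting
`m` from every entry lowers the weight of `k` selected entries by `k * m`. Once an entry is zero,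
replacing `a, 0, b` by `a + b` lowers the number of entries to be selected by one and keeps the
minimum: an optimal selection may be taken to contain either the zero or both of its neighbours
(`reduces_merge_head`). All the rules of the algorithm are iterates of this move on the cyclic
array.

The highest weight condition is what makes the rules at the two ends of the linear array correct. It
forces an even number of zeros on the left, and it passes to the next array (`nextArray_spec`).
Induction over the rounds then gives, in `blocks_spec`, that the `k` lowest rows sum to the minimum
for `k`. As that minimum does not change under rotation, the diagram does not depend on the shift
(`elimRows_eq_laxRows`). A suitable shift starts just after a minimum of the alternating partial
sums (`exists_highestWeight`).

Conservation comes from the discrete Toda lattice. Put weights `exp (-s A_j)` on the entries. The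
generating polynomial of cyclic selections is the trace of a product of 2×2 transfer matrices, and
one step of the discrete lattice conjugates that product, so the trace is invariant
(`trace_lift_eq`). The lifted evolution agrees with `exp (-s · evolve N A)` up to factors
independent of `s` (`liftEvolve_le`, `le_liftEvolve`), and the `k`-th coefficient is comparable to
`exp (-s H_k)`. Letting `s` tend to infinity gives both inequalities between the minima
(`evolve_lowerBound`, `lowerBound_evolve`). -/

/-- `PathSel l p q k w`: one can select `k` pairwise non-adjacent entries of `l` of total weight
`w`, where `p` tells whether the entry in front of `l` is selected and `q` whether the last entry
of the extended array is. -/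
def PathSel : List ℝ → Bool → Bool → ℕ → ℝ → Prop
  | [], p, q, k, w => p = q ∧ k = 0 ∧ w = 0
  | a :: l, p, q, k, w =>
    PathSel l false q k w ∨ (p = false ∧ ∃ k', k = k' + 1 ∧ PathSel l true q k' (w - a))

/-- `CycSel l k w`: one can select `k` cyclically non-adjacent entries of `l` of total weight
`w`. -/
def CycSel (l : List ℝ) (k : ℕ) (w : ℝ) : Prop := ∃ p, PathSel l p p k w

theorem pathSel_append (l₁ l₂ : List ℝ) (p q : Bool) (k : ℕ) (w : ℝ) :
    PathSel (l₁ ++ l₂) p q k w ↔ ∃ r k₁ k₂ w₁ w₂, PathSel l₁ p r k₁ w₁ ∧ PathSel l₂ r q k₂ w₂ ∧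
      k = k₁ + k₂ ∧ w = w₁ + w₂ := by
  induction l₁ generalizing p k w with
  | nil =>
    constructor
    · intro h
      exact ⟨p, 0, k, 0, w, ⟨rfl, rfl, rfl⟩, h, by simp, by simp⟩
    · rintro ⟨r, k₁, k₂, w₁, w₂, ⟨rfl, rfl, rfl⟩, h, rfl, rfl⟩
      simpa using h
  | cons a l ih =>
    simp only [List.cons_append, PathSel]
    constructor
    · rintro (h | ⟨hp, k', rfl, h⟩)
      · obtain ⟨r, k₁, k₂, w₁, w₂, h₁, h₂, hk, hw⟩ := (ih _ _ _).1 h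
        exact ⟨r, k₁, k₂, w₁, w₂, Or.inl h₁, h₂, hk, hw⟩
      · obtain ⟨r, k₁, k₂, w₁, w₂, h₁, h₂, hk, hw⟩ := (ih _ _ _).1 h
        refine ⟨r, k₁ + 1, k₂, w₁ + a, w₂, Or.inr ⟨hp, k₁, rfl, by simpa using h₁⟩, h₂, by omega,
          by linarith⟩
    · rintro ⟨r, k₁, k₂, w₁, w₂, h₁ | ⟨hp, k', rfl, h₁⟩, h₂, hk, hw⟩
      · exact Or.inl ((ih _ _ _).2 ⟨r, k₁, k₂, w₁, w₂, h₁, h₂, hk, hw⟩)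
      · exact Or.inr ⟨hp, k' + k₂, by omega,
          (ih _ _ _).2 ⟨r, k', k₂, w₁ - a, w₂, h₁, h₂, rfl, by linarith⟩⟩

theorem cycSel_append_comm_imp {l₁ l₂ : List ℝ} {k : ℕ} {w : ℝ} (h : CycSel (l₁ ++ l₂) k w) :
    CycSel (l₂ ++ l₁) k w := by
  obtain ⟨p, h⟩ := h
  obtain ⟨r, k₁, k₂, w₁, w₂, h₁, h₂, rfl, rfl⟩ := (pathSel_append _ _ _ _ _ _).1 h
  exact ⟨r, (pathSel_append _ _ _ _ _ _).2
    ⟨p, k₂, k₁, w₂, w₁, h₂, h₁, add_comm _ _, add_comm _ _⟩⟩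

theorem cycSel_append_comm (l₁ l₂ : List ℝ) (k : ℕ) (w : ℝ) :
    CycSel (l₁ ++ l₂) k w ↔ CycSel (l₂ ++ l₁) k w :=
  ⟨cycSel_append_comm_imp, cycSel_append_comm_imp⟩

theorem PathSel.of_true {l : List ℝ} {q : Bool} {k : ℕ} {w : ℝ} (h : PathSel l true q k w)
    (hl : l ≠ []) : PathSel l false q k w := by
  cases l with
  | nil => exact absurd rfl hl
  | cons a l => exact Or.inl (by simpa [PathSel] using h)

/-- Relaxing the condition in front of the array, possibly also the one at its last entry. -/
theorem PathSel.relax {l : List ℝ} {q : Bool} {k : ℕ} {w : ℝ} (h : PathSel l true q k w) :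
    ∃ q', PathSel l false q' k w ∧ (q' = true → q = true) := by
  cases l with
  | nil => exact ⟨false, ⟨rfl, h.2⟩, by simp⟩
  | cons a l => exact ⟨q, h.of_true (by simp), id⟩

theorem PathSel.nonneg {l : List ℝ} (hl : ∀ x ∈ l, 0 ≤ x) {p q : Bool} {k : ℕ} {w : ℝ}
    (h : PathSel l p q k w) : 0 ≤ w := by
  induction l generalizing p k w with
  | nil => exact h.2.2.ge
  | cons a l ih =>
    have ha := hl a (by simp)
    have hl' : ∀ x ∈ l, 0 ≤ x := fun x hx => hl x (by simp [hx])
    rcases h with h | ⟨-, k', -, h⟩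
    · exact ih hl' h
    · have := ih hl' h
      linarith

/-- Dropping one selected entry. -/
theorem PathSel.drop {l : List ℝ} (hl : ∀ x ∈ l, 0 ≤ x) {p q : Bool} {k : ℕ} {w : ℝ}
    (h : PathSel l p q (k + 1) w) :
    ∃ q' w', PathSel l p q' k w' ∧ w' ≤ w ∧ (q' = true → q = true) := by
  induction l generalizing p k w with
  | nil => exact absurd h.2.1 (by simp)
  | cons a l ih =>
    have ha := hl a (by simp)
    have hl' : ∀ x ∈ l, 0 ≤ x := fun x hx => hl x (by simp [hx])
    rcases h with h | ⟨-, k', hk, h⟩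
    · obtain ⟨q', w', h', hw, hq⟩ := ih hl' h
      exact ⟨q', w', Or.inl h', hw, hq⟩
    · obtain rfl : k = k' := by omega
      obtain ⟨q', h', hq⟩ := h.relax
      exact ⟨q', w - a, Or.inl h', by linarith, hq⟩

theorem PathSel.weaken {l : List ℝ} {p p' q : Bool} {k : ℕ} {w : ℝ} (h : PathSel l p q k w)
    (hp : p' = true → p = true) (hl : l ≠ []) : PathSel l p' q k w := by
  cases p <;> cases p' <;> simp_all
  exact h.of_true hl

theorem CycSel.nonneg {l : List ℝ} (hl : ∀ x ∈ l, 0 ≤ x) {k : ℕ} {w : ℝ} (h : CycSel l k w) :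
    0 ≤ w := h.choose_spec.nonneg hl

theorem CycSel.drop {l : List ℝ} (hl : ∀ x ∈ l, 0 ≤ x) {k : ℕ} {w : ℝ}
    (h : CycSel l (k + 1) w) : ∃ w' ≤ w, CycSel l k w' := by
  obtain ⟨p, h⟩ := h
  have hne : l ≠ [] := by
    rintro rfl
    exact absurd h.2.1 (by simp)
  obtain ⟨q', w', h', hw, hq⟩ := h.drop hl
  exact ⟨w', hw, q', h'.weaken hq hne⟩

theorem CycSel.drop_le {l : List ℝ} (hl : ∀ x ∈ l, 0 ≤ x) {j k : ℕ} (hjk : j ≤ k) {w : ℝ}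
    (h : CycSel l k w) : ∃ w' ≤ w, CycSel l j w' := by
  induction k, hjk using Nat.le_induction generalizing w with
  | base => exact ⟨w, le_rfl, h⟩
  | succ n _ ih =>
    obtain ⟨w', hw, h'⟩ := h.drop hl
    obtain ⟨w'', hw', h''⟩ := ih h'
    exact ⟨w'', hw'.trans hw, h''⟩

theorem cycSel_zero (l : List ℝ) : CycSel l 0 0 := by
  have : ∀ l : List ℝ, PathSel l false false 0 0 := by
    intro l
    induction l with
    | nil => exact ⟨rfl, rfl, rfl⟩
    | cons a l ih => exact Or.inl ih
  exact ⟨false, this l⟩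

theorem pathSel_map_sub (m : ℝ) (l : List ℝ) (p q : Bool) (k : ℕ) (w : ℝ) :
    PathSel (l.map fun a => a - m) p q k w ↔ PathSel l p q k (w + k * m) := by
  induction l generalizing p k w with
  | nil =>
    simp only [List.map_nil, PathSel]
    constructor
    · rintro ⟨h, rfl, rfl⟩
      simp [h]
    · rintro ⟨h, rfl, hw⟩
      simpa [h] using hw
  | cons a l ih =>
    simp only [List.map_cons, PathSel, ih]
    refine or_congr Iff.rfl (and_congr Iff.rfl (exists_congr fun k' => and_congr_right ?_))
    rintro rfl
    rw [show w - (a - m) + (k' : ℝ) * m = w + ((k' + 1 : ℕ) : ℝ) * m - a by push_cast; ring]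

theorem cycSel_map_sub (m : ℝ) (l : List ℝ) (k : ℕ) (w : ℝ) :
    CycSel (l.map fun a => a - m) k w ↔ CycSel l k (w + k * m) :=
  exists_congr fun _ => pathSel_map_sub _ _ _ _ _ _

/-! ### Reductions of cyclic arrays -/

/-- `Reduces n l l'`: the array `l'` is shorter than `l` by `2n`, and the minimal weight of `k + n`
cyclically non-adjacent entries of `l` is that of `k` entries of `l'`. -/
def Reduces (n : ℕ) (l l' : List ℝ) : Prop :=
  l.length = l'.length + 2 * n ∧
    ∀ k, (∀ w, CycSel l (k + n) w → ∃ w' ≤ w, CycSel l' k w') ∧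
      ∀ w, CycSel l' k w → ∃ w' ≤ w, CycSel l (k + n) w'

theorem Reduces.refl (l : List ℝ) : Reduces 0 l l :=
  ⟨by simp, fun _ => ⟨fun w h => ⟨w, le_rfl, h⟩, fun w h => ⟨w, le_rfl, h⟩⟩⟩

theorem Reduces.trans {m n : ℕ} {l l' l'' : List ℝ} (h : Reduces m l l') (h' : Reduces n l' l'') :
    Reduces (m + n) l l'' := by
  refine ⟨by rw [h.1, h'.1]; ring, fun k => ⟨fun w hw => ?_, fun w hw => ?_⟩⟩
  · obtain ⟨w', hle, hw'⟩ := (h.2 (k + n)).1 w (by rwa [show k + n + m = k + (m + n) by ring])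
    obtain ⟨w'', hle', hw''⟩ := (h'.2 k).1 w' hw'
    exact ⟨w'', hle'.trans hle, hw''⟩
  · obtain ⟨w', hle, hw'⟩ := (h'.2 k).2 w hw
    obtain ⟨w'', hle', hw''⟩ := (h.2 (k + n)).2 w' hw'
    exact ⟨w'', hle'.trans hle, by rwa [show k + (m + n) = k + n + m by ring]⟩

theorem Reduces.rotate {n : ℕ} {l₁ l₂ l₁' l₂' : List ℝ}
    (h : Reduces n (l₁ ++ l₂) (l₁' ++ l₂')) : Reduces n (l₂ ++ l₁) (l₂' ++ l₁') := by
  refine ⟨?_, fun k => ⟨fun w hw => ?_, fun w hw => ?_⟩⟩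
  · have := h.1
    simp only [List.length_append] at this ⊢
    omega
  · simp only [cycSel_append_comm l₂] at hw
    simp only [cycSel_append_comm l₂']
    exact (h.2 k).1 w hw
  · simp only [cycSel_append_comm l₂'] at hw
    simp only [cycSel_append_comm l₂]
    exact (h.2 k).2 w hw

/-- An unselected `a + b` corresponds to selecting the zero, a selected one to selecting both `a`
and `b`. Any other selection, with at most one of `a`, `b` and without the zero, does no better than
one of these after an entry is discarded. -/
theorem reduces_merge_head {a b : ℝ} {l : List ℝ} (ha : 0 ≤ a) (hb : 0 ≤ b)
    (hl : ∀ x ∈ l, 0 ≤ x) : Reduces 1 (a :: 0 :: b :: l) ((a + b) :: l) := by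
  refine ⟨by simp, fun k => ⟨?_, ?_⟩⟩
  · rintro w ⟨p, (((h | ⟨-, k', hk, h⟩) | ⟨-, k', hk, h | ⟨hf, -⟩⟩) |
      ⟨hp, k', hk, (h | ⟨-, k'', hk', h⟩) | ⟨hf, -⟩⟩)⟩
    -- With the head unselected the flag in front of it is unconstrained, so it can be reset to
    -- whatever final flag `q'` results.
    · obtain ⟨q', w', h', hw, -⟩ := h.drop hl
      exact ⟨w', hw, q', Or.inl h'⟩
    · obtain rfl : k = k' := by omega
      obtain ⟨q', h', -⟩ := h.relax
      exact ⟨w - b, by linarith, q', Or.inl h'⟩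
    · obtain rfl : k = k' := by omega
      exact ⟨w, le_rfl, p, Or.inl (by simpa using h)⟩
    · simp at hf
    · obtain rfl : k = k' := by omega
      exact ⟨w - a, by linarith, p, Or.inl h⟩
    · obtain rfl : k = k' := by omega
      subst hk'
      exact ⟨w, le_rfl, p, Or.inr ⟨hp, k'', rfl, by rwa [← sub_sub]⟩⟩
    · simp at hf
  · rintro w ⟨p, h | ⟨hp, k', rfl, h⟩⟩
    · exact ⟨w, le_rfl, p, Or.inl (Or.inr ⟨rfl, k, rfl, Or.inl (by simpa using h)⟩)⟩
    · exact ⟨w, le_rfl, p, Or.inr ⟨hp, k' + 1, rfl, Or.inl (Or.inr ⟨rfl, k', rfl,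
        by rwa [sub_sub]⟩)⟩⟩

theorem reduces_pair (a : ℝ) (ha : 0 ≤ a) : Reduces 1 [a, 0] [] := by
  refine ⟨by simp, fun k => ⟨?_, ?_⟩⟩
  · rintro w ⟨p, ((⟨-, h, -⟩ | ⟨-, k', hk, -, h, h'⟩) | ⟨hp, k', hk, (⟨-, h, h'⟩ | ⟨hf, -⟩)⟩)⟩
    · omega
    · obtain rfl : k = 0 := by omega
      exact ⟨0, by linarith, cycSel_zero _⟩
    · obtain rfl : k = 0 := by omega
      exact ⟨0, by linarith, cycSel_zero _⟩
    · simp at hf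
  · rintro w ⟨p, -, rfl, rfl⟩
    exact ⟨0, le_rfl, true, Or.inl (Or.inr ⟨rfl, 0, rfl, rfl, rfl, by simp⟩)⟩

theorem reduces_merge {c l : List ℝ} {a b : ℝ} (hc : ∀ x ∈ c, 0 ≤ x) (ha : 0 ≤ a) (hb : 0 ≤ b)
    (hl : ∀ x ∈ l, 0 ≤ x) : Reduces 1 (c ++ a :: 0 :: b :: l) (c ++ (a + b) :: l) := by
  apply Reduces.rotate
  simp only [List.cons_append]
  refine reduces_merge_head ha hb fun x hx => ?_
  rcases List.mem_append.1 hx with h | h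
  exacts [hl x h, hc x h]

/-- This is the merge of `0, 0, b` into `0 + b`, with `b` the cyclically next entry; only an array
with no further entry needs separate treatment. -/
theorem reduces_zero_zero {c l : List ℝ} (hc : ∀ x ∈ c, 0 ≤ x) (hl : ∀ x ∈ l, 0 ≤ x) :
    Reduces 1 (c ++ 0 :: 0 :: l) (c ++ l) := by
  apply Reduces.rotate
  simp only [List.cons_append]
  have h0 : ∀ x ∈ l ++ c, 0 ≤ x := fun x hx => by
    rcases List.mem_append.1 hx with h | h
    exacts [hl x h, hc x h]
  rcases hm : l ++ c with - | ⟨b, m⟩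
  · exact reduces_pair 0 le_rfl
  · rw [hm] at h0
    simpa using reduces_merge_head le_rfl (h0 b (by simp)) (fun x hx => h0 x (by simp [hx]))

theorem reduces_zeros {c l : List ℝ} (hc : ∀ x ∈ c, 0 ≤ x) (hl : ∀ x ∈ l, 0 ≤ x) (n : ℕ) :
    Reduces n (c ++ (List.replicate (2 * n) 0 ++ l)) (c ++ l) := by
  induction n with
  | zero => simpa using Reduces.refl _
  | succ n ih =>
    rw [add_comm n 1]
    refine Reduces.trans (l' := c ++ (List.replicate (2 * n) 0 ++ l)) ?_ ih
    rw [show 2 * (1 + n) = 2 * n + 1 + 1 by ring]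
    simp only [List.replicate_succ, List.cons_append]
    refine reduces_zero_zero hc fun x hx => ?_
    rcases List.mem_append.1 hx with h | h
    exacts [(List.eq_of_mem_replicate h).ge, hl x h]

/-! ### The highest weight condition for arrays -/

/-- The partial alternating sums of `l`, started with `s` and with the sign `+` or `-` of the
first entry according to `p`, are nonnegative after each negative sign. -/
def AltNonneg : Bool → ℝ → List ℝ → Prop
  | _, _, [] => True
  | true, s, a :: l => AltNonneg false (s + a) l
  | false, s, a :: l => 0 ≤ s - a ∧ AltNonneg true (s - a) l

theorem AltNonneg.mono {p : Bool} {s s' : ℝ} (hs : s ≤ s') {l : List ℝ} (h : AltNonneg p s l) :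
    AltNonneg p s' l := by
  induction l generalizing p s s' with
  | nil => cases p <;> trivial
  | cons a l ih =>
    cases p with
    | true => exact ih (by linarith) h
    | false => exact ⟨by linarith [h.1], ih (by linarith) h.2⟩

theorem AltNonneg.of_append {p : Bool} {s : ℝ} {l₁ l₂ : List ℝ} (h : AltNonneg p s (l₁ ++ l₂)) :
    AltNonneg p s l₁ := by
  induction l₁ generalizing p s with
  | nil => cases p <;> trivial
  | cons a l ih =>
    cases p with
    | true => exact ih h
    | false => exact ⟨h.1, ih h.2⟩

theorem AltNonneg.of_zeros {p : Bool} {s : ℝ} {n : ℕ} {l : List ℝ}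
    (h : AltNonneg p s (List.replicate (2 * n) 0 ++ l)) : AltNonneg p s l := by
  induction n with
  | zero => simpa using h
  | succ n ih =>
    rw [show 2 * (n + 1) = 2 * n + 1 + 1 by ring] at h
    simp only [List.replicate_succ, List.cons_append] at h
    apply ih
    cases p <;> simpa [AltNonneg] using h.2

theorem AltNonneg.of_cons_zeros {p : Bool} {s : ℝ} {n : ℕ} {a : ℝ} {l l' : List ℝ}
    (hl : ∀ p s, AltNonneg p s l → AltNonneg p s l')
    (h : AltNonneg p s (a :: (List.replicate (2 * n) 0 ++ l))) : AltNonneg p s (a :: l') := by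
  cases p with
  | true => exact hl _ _ (AltNonneg.of_zeros (n := n) h)
  | false => exact ⟨h.1, hl _ _ (AltNonneg.of_zeros (n := n) h.2)⟩

/-- An odd number of zeros between them gives `a` and `b` the same sign, so their contributions add
up. -/
theorem AltNonneg.merge {p : Bool} {s : ℝ} {n : ℕ} {a b : ℝ} {l : List ℝ}
    (h : AltNonneg p s (a :: (List.replicate (2 * n + 1) 0 ++ b :: l))) :
    AltNonneg p s ((a + b) :: l) := by
  rw [List.replicate_succ'] at h
  simp only [List.append_assoc, List.cons_append, List.nil_append] at h
  have h' := AltNonneg.of_cons_zeros (fun _ _ => id) h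
  cases p with
  | true => simpa [AltNonneg, add_assoc] using h'.2
  | false => simpa [AltNonneg, sub_sub] using h'.2

/-- The shifts by `m` cancel in pairs; only after an odd number of entries does one of them remain
in the running sum. -/
theorem AltNonneg.map_sub {s m : ℝ} {p : Bool} {l : List ℝ} (h : AltNonneg p s l) :
    AltNonneg p (if p then s else s - m) (l.map fun a => a - m) := by
  induction l generalizing p s with
  | nil => cases p <;> trivial
  | cons a l ih =>
    cases p with
    | true =>
      have := ih h
      simp only [Bool.false_eq_true, if_false] at this
      simp only [List.map_cons, AltNonneg, if_true]
      rwa [← add_sub_assoc]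
    | false =>
      have := ih h.2
      simp only [if_true] at this
      simp only [List.map_cons, AltNonneg, Bool.false_eq_true, if_false]
      rw [sub_sub_sub_cancel_right]
      exact ⟨h.1, this⟩

/-! ### One round of the elimination -/

theorem exists_zeros_append (t : List ℝ) :
    ∃ n r, t = List.replicate n 0 ++ r ∧ (∀ b r', r = b :: r' → b ≠ 0) := by
  induction t with
  | nil => exact ⟨0, [], by simp, by simp⟩
  | cons a t ih =>
    by_cases ha : a = 0
    · obtain ⟨n, r, rfl, hr⟩ := ih
      exact ⟨n + 1, r, by simp [ha, List.replicate_succ], hr⟩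
    · exact ⟨0, a :: t, by simp, by rintro b r' ⟨rfl, rfl⟩; exact ha⟩

theorem takeWhile_zeros {r : List ℝ} (hr : ∀ b r', r = b :: r' → b ≠ 0) (n : ℕ) :
    (List.replicate n 0 ++ r).takeWhile (fun b => decide (b = 0)) = List.replicate n 0 := by
  induction n with
  | zero =>
    cases r with
    | nil => simp
    | cons b r => simp [hr b r rfl]
  | succ n ih => simp [List.replicate_succ, ih]

theorem dropWhile_zeros {r : List ℝ} (hr : ∀ b r', r = b :: r' → b ≠ 0) (n : ℕ) :
    (List.replicate n 0 ++ r).dropWhile (fun b => decide (b = 0)) = r := by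
  induction n with
  | zero =>
    cases r with
    | nil => simp
    | cons b r => simp [hr b r rfl]
  | succ n ih => simp [List.replicate_succ, ih]

theorem halfZeros_cons {a : ℝ} (ha : a ≠ 0) (l : List ℝ) : halfZeros (a :: l) = halfZeros l := by
  simp [halfZeros, zeroRuns, ha]

theorem halfZeros_zeros {r : List ℝ} (hr : ∀ b r', r = b :: r' → b ≠ 0) (n : ℕ) :
    halfZeros (List.replicate n 0 ++ r) = (n + 1) / 2 + halfZeros r := by
  cases n with
  | zero => simp
  | succ n =>
    simp only [halfZeros, List.replicate_succ, List.cons_append, zeroRuns, if_true]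
    rw [takeWhile_zeros hr, dropWhile_zeros hr]
    simp [add_comm 1 n]

theorem halfZeros_nil : halfZeros [] = 0 := by simp [halfZeros, zeroRuns]

theorem halfZeros_replicate (n : ℕ) : halfZeros (List.replicate n 0) = (n + 1) / 2 := by
  simpa [halfZeros_nil] using halfZeros_zeros (r := []) (by simp) n

theorem halfZeros_pos {l : List ℝ} (h : (0 : ℝ) ∈ l) : 0 < halfZeros l := by
  induction l with
  | nil => simp at h
  | cons a l ih =>
    by_cases ha : a = 0
    · simp only [halfZeros, zeroRuns, ha, if_true, List.map_cons, List.sum_cons]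
      omega
    · rw [halfZeros_cons ha]
      exact ih (by simpa [Ne.symm ha] using h)

theorem mergeInner_zeros (a : ℝ) (n : ℕ) :
    mergeInner (a :: List.replicate n 0) = a :: List.replicate n 0 := by
  have := dropWhile_zeros (r := []) (by simp) n
  rw [List.append_nil] at this
  rw [mergeInner]
  split
  · rfl
  · simp_all

theorem mergeInner_cons (a : ℝ) (n : ℕ) {b : ℝ} (hb : b ≠ 0) (r : List ℝ) :
    mergeInner (a :: (List.replicate n 0 ++ b :: r)) =
      if Even n then a :: mergeInner (b :: r) else mergeInner ((a + b) :: r) := by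
  have hr : ∀ b' r', b :: r = b' :: r' → b' ≠ 0 := by
    rintro b' r' ⟨rfl, rfl⟩
    exact hb
  have h1 := dropWhile_zeros hr n
  have h2 := takeWhile_zeros hr n
  rw [mergeInner]
  split
  · rename_i h
    rw [h1] at h
    simp at h
  · rename_i b' r' h
    rw [h1] at h
    obtain ⟨rfl, rfl⟩ := List.cons.inj h
    rw [h2]
    simp

/-- The prefix `c` is arbitrary so that the induction can move past an entry that is kept. The `q`
trailing zeros are left for the third rule, which accounts for the summand `(q + 1) / 2`. The
induction is on length because a merge changes the head. -/
theorem mergeInner_spec (l : List ℝ) (hl : ∀ x ∈ l, 0 ≤ x)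
    (h0 : ∀ b r', l = b :: r' → b ≠ 0) :
    ∃ (n q : ℕ) (z : List ℝ), mergeInner l = z ++ List.replicate q 0 ∧ (∀ x ∈ z, 0 < x) ∧
      halfZeros l = n + (q + 1) / 2 ∧
      (∀ c : List ℝ, (∀ x ∈ c, 0 ≤ x) → Reduces n (c ++ l) (c ++ mergeInner l)) ∧
      ∀ p s, AltNonneg p s l → AltNonneg p s (mergeInner l) := by
  induction hm : l.length using Nat.strong_induction_on generalizing l with
  | _ m ih =>
  cases l with
  | nil =>
    refine ⟨0, 0, [], by simp [mergeInner], by simp, by simp [halfZeros_nil], fun c _ => ?_, ?_⟩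
    · simpa [mergeInner] using Reduces.refl c
    · simp [mergeInner]
  | cons a t =>
    have ha0 := h0 a t rfl
    have ha : 0 < a := lt_of_le_of_ne (hl a (by simp)) (Ne.symm ha0)
    obtain ⟨n, r, rfl, hr⟩ := exists_zeros_append t
    cases r with
    | nil =>
      rw [List.append_nil, mergeInner_zeros]
      refine ⟨0, n, [a], by simp, by simpa using ha, ?_, fun c _ => Reduces.refl _,
        fun _ _ => id⟩
      rw [halfZeros_cons ha0, halfZeros_replicate, zero_add]
    | cons b r =>
      have hb0 := hr b r rfl
      have hb : 0 < b := lt_of_le_of_ne (hl b (by simp)) (Ne.symm hb0)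
      have hr0 : ∀ x ∈ r, 0 ≤ x := fun x hx => hl x (by simp [hx])
      rw [mergeInner_cons a n hb0, halfZeros_cons ha0, halfZeros_zeros hr, halfZeros_cons hb0]
      simp only [List.length_cons, List.length_append, List.length_replicate] at hm
      split_ifs with hn
      · obtain ⟨j, rfl⟩ := hn.two_dvd
        obtain ⟨i, q, z, hz, hzp, hh, hred, halt⟩ := ih (r.length + 1) (by omega) (b :: r)
          (by simpa using ⟨hb.le, hr0⟩) (by rintro b' r' ⟨rfl, rfl⟩; exact hb0) rfl
        rw [halfZeros_cons hb0] at hh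
        refine ⟨j + i, q, a :: z, by simp [hz], by simpa using ⟨ha, hzp⟩, by omega, ?_, ?_⟩
        · intro c hc
          have hc' : ∀ x ∈ c ++ [a], 0 ≤ x := by
            intro x hx
            rcases List.mem_append.1 hx with h | h
            · exact hc x h
            · simp only [List.mem_singleton] at h
              exact h ▸ ha.le
          have h1 := reduces_zeros hc' (l := b :: r) (by simpa using ⟨hb.le, hr0⟩) j
          simpa using h1.trans (hred (c ++ [a]) hc')
        · intro p s h
          exact AltNonneg.of_cons_zeros halt h
      · obtain ⟨j, rfl⟩ := Nat.not_even_iff_odd.1 hn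
        have hab : 0 < a + b := by linarith
        obtain ⟨i, q, z, hz, hzp, hh, hred, halt⟩ := ih (r.length + 1) (by omega)
          ((a + b) :: r)
          (by simpa using ⟨hab.le, hr0⟩) (by rintro b' r' ⟨rfl, rfl⟩; exact hab.ne') rfl
        rw [halfZeros_cons hab.ne'] at hh
        refine ⟨j + (1 + i), q, z, hz, hzp, by omega, ?_, ?_⟩
        · intro c hc
          have hc' : ∀ x ∈ c ++ [a], 0 ≤ x := by
            intro x hx
            rcases List.mem_append.1 hx with h | h
            · exact hc x h
            · simp only [List.mem_singleton] at h
              exact h ▸ ha.le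
          -- Of the `2 * j + 1` zeros, `2 * j` disappear in pairs and the last one is used up by the
          -- merge.
          have h1 := reduces_zeros hc' (l := 0 :: b :: r) (by simpa using ⟨hb.le, hr0⟩) j
          rw [List.replicate_succ']
          simp only [List.append_assoc, List.cons_append, List.nil_append] at h1 ⊢
          exact h1.trans ((reduces_merge hc ha.le hb.le hr0).trans (hred c hc))
        · intro p s h
          exact halt _ _ h.merge

theorem dropRight_append {z : List ℝ} (hz : ∀ x ∈ z, 0 < x) (q : ℕ) :
    dropRight (z ++ List.replicate q 0) =
      if Even q then z else z.dropLast.modifyHead fun a => a + z.getLastD 0 := by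
  have hr : ∀ b r', z.reverse = b :: r' → b ≠ 0 := by
    intro b r' h
    exact (hz b (by rw [← List.mem_reverse, h]; simp)).ne'
  simp only [dropRight, List.rdropWhile, List.rtakeWhile, List.reverse_append,
    List.reverse_replicate, dropWhile_zeros hr, takeWhile_zeros hr, List.reverse_reverse,
    List.length_replicate]

/-- For an odd number of trailing zeros the last entry, one zero and the first entry are cyclically
consecutive, so the third rule is a merge across the end. Partial sums survive: the tail is cut off
and the first entry, which carries a plus sign, only grows. -/
theorem dropRight_spec {z : List ℝ} (hz : ∀ x ∈ z, 0 < x) (q : ℕ)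
    (hlen : Even (z ++ List.replicate q 0).length)
    (halt : AltNonneg true 0 (z ++ List.replicate q 0)) :
    Reduces ((q + 1) / 2) (z ++ List.replicate q 0) (dropRight (z ++ List.replicate q 0)) ∧
      AltNonneg true 0 (dropRight (z ++ List.replicate q 0)) ∧
      ∀ x ∈ dropRight (z ++ List.replicate q 0), 0 ≤ x := by
  have hz' : ∀ x ∈ z, 0 ≤ x := fun x hx => (hz x hx).le
  rw [dropRight_append hz]
  have hz1 := halt.of_append
  split_ifs with hq
  · obtain ⟨j, rfl⟩ := hq.two_dvd
    refine ⟨?_, hz1, hz'⟩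
    rw [show (2 * j + 1) / 2 = j by omega]
    simpa using reduces_zeros hz' (l := []) (by simp) j
  · obtain ⟨j, rfl⟩ := Nat.not_even_iff_odd.1 hq
    rw [show (2 * j + 1 + 1) / 2 = j + 1 by omega]
    have hred : Reduces j (z ++ List.replicate (2 * j + 1) 0) (z ++ [0]) := by
      rw [List.replicate_succ']
      exact reduces_zeros hz' (l := [0]) (by simp) j
    -- The empty `z` is excluded by parity of the length. For a single `x` the added value is lost,
    -- as in the pair `x, 0` reducing to the empty array.
    rcases List.eq_nil_or_concat' z with rfl | ⟨m, x, rfl⟩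
    · simp at hlen
    simp only [List.dropLast_concat, List.getLastD_concat]
    cases m with
    | nil =>
      refine ⟨hred.trans ?_, by trivial, by simp⟩
      simpa using reduces_pair x (hz' x (by simp))
    | cons f m =>
      have hx := hz' x (by simp)
      have hf := hz' f (by simp)
      have hm : ∀ y ∈ m, 0 ≤ y := fun y hy => hz' y (by simp [hy])
      refine ⟨hred.trans ?_, ?_, ?_⟩
      · have h1 := reduces_merge_head hx hf hm
        have h2 := Reduces.rotate (l₁ := [x, 0]) (l₂ := f :: m) (l₁' := (x + f) :: m) (l₂' := [])
          (by simpa using h1)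
        simpa [add_comm] using h2
      · have h1 : AltNonneg false (0 + f) m := AltNonneg.of_append (l₁ := f :: m) hz1
        exact h1.mono (by linarith)
      · simp only [List.modifyHead_cons, List.mem_cons, forall_eq_or_imp]
        exact ⟨by linarith, hm⟩

theorem arrMin_spec {x : List ℝ} (hx : x ≠ []) : arrMin x ∈ x ∧ ∀ a ∈ x, arrMin x ≤ a := by
  obtain ⟨m, hm⟩ := WithTop.ne_top_iff_exists.1 (List.minimum_ne_top_of_ne_nil hx)
  have h : arrMin x = m := by simp [arrMin, ← hm]
  rw [h]
  exact ⟨List.minimum_mem hm.symm, fun a ha => List.minimum_le_of_mem ha hm.symm⟩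

/-- After an odd number of zeros the first positive entry would carry a minus sign and make its
partial sum negative; an array of zeros only is even by length. -/
theorem zeros_even_of_altNonneg {n : ℕ} {d : List ℝ} (hd : ∀ b r, d = b :: r → 0 < b)
    (hlen : Even (List.replicate n (0 : ℝ) ++ d).length)
    (h : AltNonneg true 0 (List.replicate n 0 ++ d)) : Even n := by
  cases d with
  | nil => simpa using hlen
  | cons b r =>
    by_contra hn
    obtain ⟨j, rfl⟩ := Nat.not_even_iff_odd.1 hn
    rw [List.replicate_succ'] at h
    simp only [List.append_assoc, List.cons_append, List.nil_append] at h
    have h1 := h.of_zeros.1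
    have := hd b r rfl
    linarith

theorem nextArray_spec {x : List ℝ} (hx : x ≠ []) (hlen : Even x.length)
    (halt : AltNonneg true 0 x) :
    Reduces (halfZeros (subMin x)) (subMin x) (nextArray x) ∧ 0 < halfZeros (subMin x) ∧
      AltNonneg true 0 (nextArray x) ∧ ∀ a ∈ nextArray x, 0 ≤ a := by
  obtain ⟨hmem, hle⟩ := arrMin_spec hx
  have hy0 : ∀ a ∈ subMin x, 0 ≤ a := by
    intro a ha
    obtain ⟨b, hb, rfl⟩ := List.mem_map.1 ha
    exact sub_nonneg.2 (hle b hb)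
  have hpos : 0 < halfZeros (subMin x) :=
    halfZeros_pos (List.mem_map.2 ⟨_, hmem, sub_self _⟩)
  have hyalt : AltNonneg true 0 (subMin x) := halt.map_sub
  have hylen : Even (subMin x).length := by simpa [subMin] using hlen
  rw [nextArray]
  generalize subMin x = y at *
  obtain ⟨n, d, rfl, hd⟩ := exists_zeros_append y
  have hd0 : ∀ a ∈ d, 0 ≤ a := fun a ha => hy0 a (by simp [ha])
  have hn := zeros_even_of_altNonneg (fun b r h => lt_of_le_of_ne
    (hd0 b (by simp [h])) (Ne.symm (hd b r h))) hylen hyalt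
  obtain ⟨j, rfl⟩ := hn.two_dvd
  rw [dropLeft, dropWhile_zeros hd, halfZeros_zeros hd]
  rw [halfZeros_zeros hd] at hpos
  have hred := reduces_zeros (c := []) (by simp) hd0 j
  obtain ⟨i, q, z, hz, hzp, hh, hred', halt'⟩ := mergeInner_spec d hd0 hd
  have hred'' := hred.trans (hred' [] (by simp))
  have halt'' := halt' _ _ hyalt.of_zeros
  rw [hz] at halt'' hred'' ⊢
  simp only [List.nil_append] at hred''
  have hlen'' : Even (z ++ List.replicate q (0 : ℝ)).length := by
    have := hred''.1
    rw [this] at hylen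
    simpa [Nat.even_add] using hylen
  obtain ⟨h1, h2, h3⟩ := dropRight_spec hzp q hlen'' halt''
  refine ⟨?_, hpos, h2, h3⟩
  rw [hh, show (2 * j + 1) / 2 + (i + (q + 1) / 2) = j + i + (q + 1) / 2 by omega]
  exact hred''.trans h1

/-! ### The diagram of the elimination -/

/-- The empty selection of `l'` lifts to `n` entries of weight zero in `l`, from which entries can
be dropped. -/
theorem Reduces.cycSel_zero_weight {n : ℕ} {l l' : List ℝ} (h : Reduces n l l')
    (hl : ∀ x ∈ l, 0 ≤ x) {k : ℕ} (hk : k ≤ n) : CycSel l k 0 := by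
  obtain ⟨w, hw, hs⟩ := (h.2 0).2 0 (cycSel_zero l')
  rw [zero_add] at hs
  obtain ⟨w', hw', hs'⟩ := hs.drop_le hl hk
  obtain rfl : w' = 0 := le_antisymm (hw'.trans hw) (hs'.nonneg hl)
  exact hs'

theorem Reduces.isLeast {n : ℕ} {l l' : List ℝ} (h : Reduces n l l') {k : ℕ} {v : ℝ}
    (hv : IsLeast {v | CycSel l' k v} v) : IsLeast {v | CycSel l (k + n) v} v := by
  have hlb : ∀ w, CycSel l (k + n) w → v ≤ w := by
    intro w hw
    obtain ⟨w', hle, hw'⟩ := (h.2 k).1 w hw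
    exact (hv.2 hw').trans hle
  obtain ⟨w, hle, hw⟩ := (h.2 k).2 v hv.1
  obtain rfl : w = v := le_antisymm hle (hlb w hw)
  exact ⟨hw, fun w' => hlb w'⟩

theorem isLeast_of_subMin {x : List ℝ} {k : ℕ} {v : ℝ}
    (h : IsLeast {v | CycSel (subMin x) k v} v) :
    IsLeast {v | CycSel x k v} (v + k * arrMin x) := by
  refine ⟨(cycSel_map_sub _ _ _ _).1 h.1, fun w hw => ?_⟩
  have : CycSel (subMin x) k (w - k * arrMin x) :=
    (cycSel_map_sub _ _ _ _).2 (by simpa using hw)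
  have := h.2 this
  linarith

theorem blocks_zero (x : List ℝ) : blocks 0 x = [] := by
  rw [blocks]
  simp

/-- The offset `w` records the strip already built by earlier rounds. For `k` at most the number of
rows of the first block, the minimum after subtraction is zero; beyond it, the count passes to the
next array. The last clause carries the lower bound that yields monotone rows and, later, positive
ones. -/
theorem blocks_spec (N : ℕ) (x : List ℝ) (hlen : x.length = 2 * N) (halt : AltNonneg true 0 x)
    (w : ℝ) :
    (rowsFrom w (blocks N x)).length = N ∧
      (∀ k ≤ N, IsLeast {v | CycSel x k v} (((rowsFrom w (blocks N x)).take k).sum - k * w)) ∧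
      (rowsFrom w (blocks N x)).Pairwise (· ≤ ·) ∧
      ∀ m, (∀ a ∈ x, m ≤ a) → ∀ r ∈ rowsFrom w (blocks N x), w + m ≤ r := by
  induction N using Nat.strong_induction_on generalizing x w with
  | _ N ih =>
  rcases Nat.eq_zero_or_pos N with rfl | hN
  · obtain rfl : x = [] := List.eq_nil_of_length_eq_zero (by simpa using hlen)
    rw [blocks_zero]
    refine ⟨rfl, fun k hk => ?_, by simp [rowsFrom], by simp [rowsFrom]⟩
    obtain rfl : k = 0 := by omega
    refine ⟨by simpa [rowsFrom] using cycSel_zero [], ?_⟩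
    rintro v ⟨p, -, -, rfl⟩
    simp [rowsFrom]
  · have hx : x ≠ [] := by
      rintro rfl
      simp at hlen
      omega
    obtain ⟨hred, hpos, halt', hnn⟩ := nextArray_spec hx (by simp [hlen]) halt
    obtain ⟨hmem, hle⟩ := arrMin_spec hx
    have hy0 : ∀ a ∈ subMin x, 0 ≤ a := by
      intro a ha
      obtain ⟨b, hb, rfl⟩ := List.mem_map.1 ha
      exact sub_nonneg.2 (hle b hb)
    have hl := hred.1
    rw [show (subMin x).length = 2 * N by simp [subMin, hlen]] at hl
    have hb : blocks N x = (arrMin x, N - (N - halfZeros (subMin x))) ::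
        blocks (N - halfZeros (subMin x)) (nextArray x) := by
      rw [blocks, dif_pos ⟨hN, hpos⟩]
    generalize hν : halfZeros (subMin x) = ν at *
    have hνN : ν ≤ N := by omega
    rw [Nat.sub_sub_self hνN] at hb
    obtain ⟨ih1, ih2, ih3, ih4⟩ := ih (N - ν) (by omega) (nextArray x) (by omega) halt'
      (w + arrMin x)
    simp only [hb, rowsFrom]
    refine ⟨by rw [List.length_append, ih1, List.length_replicate]; omega, ?_, ?_, ?_⟩
    · intro k hk
      by_cases hkν : k ≤ ν
      · have h1 : IsLeast {v | CycSel (subMin x) k v} 0 :=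
          ⟨hred.cycSel_zero_weight hy0 hkν, fun v hv => CycSel.nonneg hy0 hv⟩
        convert isLeast_of_subMin h1 using 1
        rw [List.take_append_of_le_length (by simpa using hkν), List.take_replicate,
          min_eq_left hkν, List.sum_replicate, nsmul_eq_mul]
        ring
      · obtain ⟨j, rfl⟩ := Nat.exists_eq_add_of_le (le_of_not_ge hkν)
        have h1 := isLeast_of_subMin (hred.isLeast (ih2 j (by omega)))
        rw [add_comm j ν] at h1
        convert h1 using 1
        rw [List.take_append, List.length_replicate, Nat.add_sub_cancel_left, List.sum_append,
          List.take_of_length_le (by simp), List.sum_replicate, nsmul_eq_mul]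
        push_cast
        ring
    · refine List.pairwise_append.2 ⟨by simp [List.pairwise_replicate], ih3, ?_⟩
      intro a ha b hb
      -- Nonnegativity of the next array makes every later row at least as long as those of the
      -- first block.
      rw [List.eq_of_mem_replicate ha]
      simpa using ih4 0 hnn b hb
    · intro m hm r hr
      have h1 : m ≤ arrMin x := hm _ hmem
      rcases List.mem_append.1 hr with h | h
      · rw [List.eq_of_mem_replicate h]
        linarith
      · have := ih4 0 hnn r h
        linarith

theorem toArray_length (N : ℕ) (A : ZMod (2 * N) → ℝ) : (toArray N A).length = 2 * N := by
  simp [toArray]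

theorem mem_toArray {N : ℕ} {A : ZMod (2 * N) → ℝ} {a : ℝ} (h : a ∈ toArray N A) :
    ∃ j, A j = a := by
  obtain ⟨i, -, hi⟩ := List.mem_map.1 h
  exact ⟨_, hi⟩

theorem sum_Icc_one (g : ℕ → ℝ) (k : ℕ) :
    ∑ i ∈ Finset.Icc 1 k, g i = ∑ i ∈ Finset.range k, g (i + 1) := by
  induction k with
  | zero => simp
  | succ k ih => rw [Finset.sum_Icc_succ_top (by omega), ih, Finset.sum_range_succ]

theorem altNonneg_map_range' (f : ℕ → ℝ) (n a : ℕ) (s : ℝ)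
    (h : ∀ k ≤ n, 0 ≤ s + ∑ i ∈ Finset.range k, (f (a + 2 * i) - f (a + 2 * i + 1))) :
    AltNonneg true s ((List.range' a (2 * n)).map f) := by
  induction n generalizing a s with
  | zero => trivial
  | succ n ih =>
    rw [show 2 * (n + 1) = 2 * n + 1 + 1 by ring]
    simp only [List.range'_succ, List.map_cons, AltNonneg]
    have h1 := h 1 (by omega)
    simp only [Finset.sum_range_one, mul_zero, add_zero] at h1
    refine ⟨by linarith, ih _ _ fun k hk => ?_⟩
    have h2 := h (k + 1) (by omega)
    rw [Finset.sum_range_succ'] at h2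
    simp only [mul_zero, add_zero] at h2
    have h3 : ∀ i, a + 1 + 1 + 2 * i = a + 2 * (i + 1) := fun i => by ring
    simp only [h3]
    linarith

theorem toArray_eq (N : ℕ) (A : ZMod (2 * N) → ℝ) :
    toArray N A = (List.range' 1 (2 * N)).map fun i : ℕ => A (i : ZMod (2 * N)) := by
  rw [List.range'_eq_map_range, List.map_map, toArray]
  refine List.map_congr_left fun i _ => ?_
  simp [add_comm]

theorem HighestWeight.altNonneg {N : ℕ} {A : ZMod (2 * N) → ℝ} (h : HighestWeight N A) :
    AltNonneg true 0 (toArray N A) := by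
  rw [toArray_eq]
  refine altNonneg_map_range' _ _ _ _ fun k hk => ?_
  rcases Nat.eq_zero_or_pos k with rfl | hk0
  · simp
  have := h k (Finset.mem_Icc.2 ⟨hk0, hk⟩)
  rw [sum_Icc_one (fun i => A (2 * (i : ZMod (2 * N)) - 1) - A (2 * (i : ZMod (2 * N))))] at this
  rw [zero_add]
  refine this.trans_eq (Finset.sum_congr rfl fun i _ => ?_)
  congr 2 <;> push_cast <;> ring

/-! ### The conserved quantities -/

/-- This translates the recursive selections into index sets; on an empty array the final flag is
the initial one, hence the case distinction on `n`. -/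
theorem pathSel_map_range' (f : ℕ → ℝ) (n a : ℕ) (p q : Bool) (k : ℕ) (w : ℝ) :
    PathSel ((List.range' a n).map f) p q k w ↔
      ∃ S ⊆ Finset.Ico a (a + n), (∀ i ∈ S, i + 1 ∉ S) ∧ (p = true → a ∉ S) ∧ S.card = k ∧
        ∑ i ∈ S, f i = w ∧ q = if n = 0 then p else decide (a + n - 1 ∈ S) := by
  induction n generalizing a p k w with
  | zero =>
    simp only [List.range'_zero, List.map_nil, PathSel, add_zero, Finset.Ico_self,
      Finset.subset_empty, if_true]
    constructor
    · rintro ⟨rfl, rfl, rfl⟩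
      exact ⟨∅, rfl, by simp, by simp, by simp, by simp, rfl⟩
    · rintro ⟨S, rfl, -, -, rfl, rfl, rfl⟩
      simp
  | succ n ih =>
    simp only [List.range'_succ, List.map_cons, PathSel, ih]
    simp only [Nat.add_eq_zero_iff, one_ne_zero, and_false, if_false,
      show a + 1 + n = a + (n + 1) by ring, show a + (n + 1) - 1 = a + n by omega]
    have key : ∀ S ⊆ Finset.Ico (a + 1) (a + (n + 1)), a ∉ S := fun S hS ha => by
      have := Finset.mem_Ico.1 (hS ha)
      omega
    constructor
    · rintro (⟨S, hS, hind, -, hc, hw, hq⟩ | ⟨rfl, k', rfl, S, hS, hind, hp, hc, hw, hq⟩)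
      · have ha := key S hS
        refine ⟨S, hS.trans (Finset.Ico_subset_Ico_left (by omega)), hind, fun _ => ha, hc, hw, ?_⟩
        rw [hq]
        split_ifs with hn
        · subst hn
          simpa using ha
        · rfl
      · have ha := key S hS
        have ha1 : a + 1 ∉ S := hp trivial
        refine ⟨insert a S, ?_, ?_, by simp, by rw [Finset.card_insert_of_notMem ha, hc], ?_, ?_⟩
        · refine Finset.insert_subset (by simp) (hS.trans (Finset.Ico_subset_Ico_left (by omega)))
        · intro i hi hi'
          rcases Finset.mem_insert.1 hi with rfl | hi
          · exact ha1 (by simpa using hi')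
          · have := Finset.mem_Ico.1 (hS hi)
            rcases Finset.mem_insert.1 hi' with h | h
            · omega
            · exact hind i hi h
        · rw [Finset.sum_insert ha, hw]
          ring
        · rw [hq]
          split_ifs with hn
          · simp [hn]
          · simp [hn]
    · rintro ⟨S, hS, hind, hp, hc, hw, hq⟩
      by_cases ha : a ∈ S
      · right
        have hpf : p = false := by
          cases p
          · rfl
          · exact absurd ha (hp rfl)
        refine ⟨hpf, k - 1, ?_, S.erase a, ?_, ?_, ?_, ?_, ?_, ?_⟩
        · have := Finset.card_pos.2 ⟨a, ha⟩
          omega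
        · intro i hi
          obtain ⟨h1, h2⟩ := Finset.mem_erase.1 hi
          have := Finset.mem_Ico.1 (hS h2)
          exact Finset.mem_Ico.2 (by omega)
        · intro i hi hi'
          exact hind i (Finset.mem_of_mem_erase hi) (Finset.mem_of_mem_erase hi')
        · intro _ h
          exact hind a ha (Finset.mem_of_mem_erase h)
        · rw [Finset.card_erase_of_mem ha, hc]
        · rw [← hw, ← Finset.add_sum_erase S f ha]
          ring
        · rw [hq]
          split_ifs with hn
          · simp [hn, ha]
          · simp [hn]
      · left
        refine ⟨S, ?_, hind, by simp, hc, hw, ?_⟩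
        · intro i hi
          have := Finset.mem_Ico.1 (hS hi)
          have : i ≠ a := by
            rintro rfl
            exact ha hi
          exact Finset.mem_Ico.2 (by omega)
        · rw [hq]
          split_ifs with hn
          · simp [hn, ha]
          · rfl

theorem cycSel_toArray {N : ℕ} (hN : 1 ≤ N) (A : ZMod (2 * N) → ℝ) (k : ℕ) (w : ℝ) :
    CycSel (toArray N A) k w ↔
      ∃ S ∈ exclSets N k, ∑ i ∈ S, A (i : ZMod (2 * N)) = w := by
  have hIco : Finset.Ico 1 (1 + 2 * N) = Finset.Icc 1 (2 * N) := by
    ext i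
    simp only [Finset.mem_Ico, Finset.mem_Icc]
    omega
  rw [toArray_eq, CycSel]
  simp only [pathSel_map_range', exclSets, Finset.mem_filter, Finset.mem_powersetCard, hIco]
  rw [show 1 + 2 * N - 1 = 2 * N by omega]
  constructor
  · rintro ⟨p, S, hS, hind, hp, hc, hw, hq⟩
    rw [if_neg (by omega)] at hq
    exact ⟨S, ⟨⟨hS, hc⟩, hind, fun h => hp (by simpa [hq] using h.2) h.1⟩, hw⟩
  · rintro ⟨S, ⟨⟨hS, hc⟩, hind, hne⟩, hw⟩
    -- Taking the initial flag to be the status of index `2 * N` turns the exclusion of the pair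
    -- `(1, 2 * N)` into the usual non-adjacency condition.
    refine ⟨decide (2 * N ∈ S), S, hS, hind, fun h h1 => hne ⟨h1, by simpa using h⟩, hc, hw, ?_⟩
    rw [if_neg (by omega)]

theorem consH_eq {N : ℕ} (hN : 1 ≤ N) {A : ZMod (2 * N) → ℝ} {k : ℕ} {v : ℝ}
    (h : IsLeast {v | CycSel (toArray N A) k v} v) : consH N A k = v := by
  obtain ⟨S, hS, hv⟩ := (cycSel_toArray hN A k v).1 h.1
  have hne : (exclSets N k).Nonempty := ⟨S, hS⟩
  rw [consH, dif_pos hne]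
  refine le_antisymm ((Finset.inf'_le _ hS).trans hv.le) (Finset.le_inf' _ _ fun T hT => ?_)
  exact h.2 ((cycSel_toArray hN A k _).2 ⟨T, hT, rfl⟩)

theorem cycSel_rotate {M : ℕ} {g : ℕ → ℝ} (hg : ∀ i, g (i + M) = g i) (k : ℕ) (w : ℝ) :
    CycSel ((List.range M).map fun i => g (i + 1)) k w ↔ CycSel ((List.range M).map g) k w := by
  cases M with
  | zero => simp
  | succ m =>
    have h1 : (List.range (m + 1)).map g = [g 0] ++ (List.range m).map fun i => g (i + 1) := by
      rw [List.range_succ_eq_map]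
      simp [Function.comp_def]
    have h2 : ((List.range (m + 1)).map fun i => g (i + 1)) =
        ((List.range m).map fun i => g (i + 1)) ++ [g 0] := by
      rw [List.range_succ, List.map_append]
      simp [← hg 0]
    rw [h1, h2, cycSel_append_comm]

theorem cycSel_toArray_add {N : ℕ} (A : ZMod (2 * N) → ℝ) (j : ℕ) (k : ℕ) (w : ℝ) :
    CycSel (toArray N fun i => A (i + (j : ZMod (2 * N)))) k w ↔ CycSel (toArray N A) k w := by
  induction j with
  | zero => simp
  | succ j ih =>
    rw [← ih]
    have hp : ((2 * N : ℕ) : ZMod (2 * N)) = 0 := ZMod.natCast_self _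
    have := cycSel_rotate (M := 2 * N) (g := fun i => A (((i + 1 : ℕ) : ZMod (2 * N)) + (j : ℕ)))
      (fun i => by
        rw [show i + 2 * N + 1 = i + 1 + 2 * N by ring, Nat.cast_add (i + 1), hp, add_zero]) k w
    rw [toArray, toArray, ← this]
    have h : ∀ i : ℕ, ((i + 1 : ℕ) : ZMod (2 * N)) + ((j + 1 : ℕ) : ZMod (2 * N)) =
        ((i + 1 + 1 : ℕ) : ZMod (2 * N)) + (j : ℕ) := fun i => by push_cast; ring
    simp only [h]

theorem cycSel_toArray_shift {N : ℕ} (hN : 1 ≤ N) (A : ZMod (2 * N) → ℝ) (n : ZMod (2 * N))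
    (k : ℕ) (w : ℝ) : CycSel (toArray N (shift N n A)) k w ↔ CycSel (toArray N A) k w := by
  have : NeZero (2 * N) := ⟨by omega⟩
  have := cycSel_toArray_add A (2 * n).val k w
  rwa [ZMod.natCast_zmod_val] at this

theorem isLeast_elimRows {N : ℕ} (hN : 1 ≤ N) {A : ZMod (2 * N) → ℝ} {n : ZMod (2 * N)}
    (h : HighestWeight N (shift N n A)) {k : ℕ} (hk : k ≤ N) :
    IsLeast {v | CycSel (toArray N A) k v} ((elimRows N (shift N n A)).take k).sum := by
  have := (blocks_spec N _ (toArray_length _ _) h.altNonneg 0).2.1 k hk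
  simpa only [cycSel_toArray_shift hN, mul_zero, sub_zero, elimRows] using this

theorem elimRows_length {N : ℕ} {A : ZMod (2 * N) → ℝ} (h : HighestWeight N A) :
    (elimRows N A).length = N :=
  (blocks_spec N _ (toArray_length _ _) h.altNonneg 0).1

theorem sum_take_elimRows {N : ℕ} (hN : 1 ≤ N) {A : ZMod (2 * N) → ℝ} {n : ZMod (2 * N)}
    (h : HighestWeight N (shift N n A)) {k : ℕ} (hk : k ≤ N) :
    ((elimRows N (shift N n A)).take k).sum = consH N A k :=
  (consH_eq hN (isLeast_elimRows hN h hk)).symm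

theorem elimRows_eq_laxRows {N : ℕ} (hN : 1 ≤ N) {A : ZMod (2 * N) → ℝ} {n : ZMod (2 * N)}
    (h : HighestWeight N (shift N n A)) : elimRows N (shift N n A) = laxRows N A := by
  have hl := elimRows_length h
  refine List.ext_getElem (by simp [hl, laxRows]) fun j hj _ => ?_
  rw [hl] at hj
  have h1 := sum_take_elimRows hN h (k := j + 1) hj
  rw [List.sum_take_succ _ _ (by omega), sum_take_elimRows hN h hj.le] at h1
  simp only [laxRows, List.getElem_map, List.getElem_range]
  linarith

theorem elimRows_pos {N : ℕ} (hN : 1 ≤ N) {A : ZMod (2 * N) → ℝ} (hA : ∀ j, 0 < A j)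
    (h : HighestWeight N A) {r : ℝ} (hr : r ∈ elimRows N A) : 0 < r := by
  have hne : toArray N A ≠ [] := by
    intro h0
    have := toArray_length N A
    rw [h0] at this
    simp at this
    omega
  obtain ⟨hmem, hle⟩ := arrMin_spec hne
  obtain ⟨j, hj⟩ := mem_toArray hmem
  have := (blocks_spec N _ (toArray_length _ _) h.altNonneg 0).2.2.2 _ hle r hr
  linarith [hA j]

theorem elimRows_pairwise {N : ℕ} {A : ZMod (2 * N) → ℝ} (h : HighestWeight N A) :
    (elimRows N A).Pairwise (· ≤ ·) :=
  (blocks_spec N _ (toArray_length _ _) h.altNonneg 0).2.2.1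

/-! ### Areas -/

theorem areaBelow_eq {rows : List ℝ} (h : ∀ r ∈ rows, 0 ≤ r) {k : ℕ} (hk : k ≤ rows.length) :
    areaBelow rows k = ENNReal.ofReal (rows.take k).sum := by
  have hset : region rows ∩ {p | p.2 < (k : ℝ)} =
      ⋃ j ∈ Finset.range k, Set.Icc 0 (rows.getD j 0) ×ˢ Set.Ico (j : ℝ) ((j : ℝ) + 1) := by
    ext p
    simp only [region, Set.mem_inter_iff, Set.mem_ofPred_eq, Set.mem_iUnion, Finset.mem_range,
      Set.mem_prod, exists_prop]
    constructor
    · rintro ⟨⟨j, hj, h1, h2⟩, h3⟩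
      have : (j : ℝ) < k := h2.1.trans_lt h3
      refine ⟨j, by exact_mod_cast this, ?_, h2⟩
      rwa [List.getD_eq_getElem _ _ hj]
    · rintro ⟨j, hj, h1, h2⟩
      have hj' : j < rows.length := by omega
      rw [List.getD_eq_getElem _ _ hj'] at h1
      have : (j : ℝ) + 1 ≤ k := by exact_mod_cast hj
      exact ⟨⟨j, hj', h1, h2⟩, h2.2.trans_le this⟩
  rw [areaBelow, hset, MeasureTheory.measure_biUnion_finset]
  · have hvol : ∀ j : ℕ, MeasureTheory.volume
        (Set.Icc 0 (rows.getD j 0) ×ˢ Set.Ico (j : ℝ) ((j : ℝ) + 1)) =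
        ENNReal.ofReal (rows.getD j 0) := by
      intro j
      rw [MeasureTheory.Measure.volume_eq_prod, MeasureTheory.Measure.prod_prod]
      simp
    have hnn : ∀ j, 0 ≤ rows.getD j 0 := by
      intro j
      by_cases hj : j < rows.length
      · rw [List.getD_eq_getElem _ _ hj]
        exact h _ (List.getElem_mem hj)
      · rw [List.getD_eq_default _ _ (by omega)]
    simp only [hvol]
    rw [← ENNReal.ofReal_sum_of_nonneg fun j _ => hnn j]
    congr 1
    clear hset
    induction k with
    | zero => simp
    | succ k ih =>
      rw [Finset.sum_range_succ, ih (by omega), List.sum_take_succ _ _ (by omega),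
        List.getD_eq_getElem]
  · intro i _ j _ hij
    refine Set.disjoint_left.2 fun p hp hp' => hij ?_
    obtain ⟨h1, h2⟩ := hp.2
    obtain ⟨h3, h4⟩ := hp'.2
    have h5 : (i : ℝ) < j + 1 := h1.trans_lt h4
    have h6 : (j : ℝ) < i + 1 := h3.trans_lt h2
    have h7 : i < j + 1 := by exact_mod_cast h5
    have h8 : j < i + 1 := by exact_mod_cast h6
    omega
  · intro j _
    exact measurableSet_Icc.prod measurableSet_Ico

/-! ### Transfer matrices -/

open Polynomial in
/-- The transfer matrix for the generating polynomial of the selections of non-adjacent entries. -/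
noncomputable def transfer (x : ℝ) : Matrix Bool Bool ℝ[X] :=
  Matrix.of fun p q => if q then (if p then 0 else C x * X) else 1

open Polynomial in
/-- The gauge transformation which intertwines the transfer matrices of two consecutive states. -/
noncomputable def gauge (u : ℝ) : Matrix Bool Bool ℝ[X] :=
  Matrix.of fun p q => if p = q then 1 else if q then -(C u * X) else 0

theorem gauge_mul_gauge_neg (u : ℝ) : gauge u * gauge (-u) = 1 := by
  ext p q
  cases p <;> cases q <;> simp [gauge, Matrix.mul_apply]

/-- The hypotheses are the local equations of the discrete Toda lattice, with `u` as carrier: moving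
the gauge matrix through a pair of sites exchanges the two factors and updates them. -/
theorem transfer_gauge {W Q u u' Q' W' : ℝ} (h₁ : Q' = u + W) (h₂ : u' + W' = Q)
    (h₃ : u * W' = u' * W) :
    transfer W * transfer Q * gauge u' = gauge u * (transfer Q' * transfer W') := by
  subst h₁ h₂
  have h₃' : (Polynomial.C u * Polynomial.C W' : Polynomial ℝ) =
      Polynomial.C u' * Polynomial.C W := by rw [← Polynomial.C_mul, h₃, Polynomial.C_mul]
  ext1 p q
  cases p <;> cases q <;>
    simp only [transfer, gauge, Matrix.mul_apply, Matrix.of_apply, Fintype.sum_bool,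
      Polynomial.C_add, if_true, Bool.false_eq_true, if_false, reduceCtorEq] <;>
    first
    | ring1
    | linear_combination (Polynomial.X ^ 2) * h₃'

/-- The local relations telescope along the chain, and the periodicity of the carrier turns the
result into a conjugation, which the trace does not see. -/
theorem trace_prod_transfer_eq {x b u : ℕ → ℝ} (N : ℕ) (h₁ : ∀ n, b (2 * n) = u n + x (2 * n + 1))
    (h₂ : ∀ n, u (n + 1) + b (2 * n + 1) = x (2 * n + 2))
    (h₃ : ∀ n, u n * b (2 * n + 1) = u (n + 1) * x (2 * n + 1)) (hu : u N = u 0) :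
    ((((List.range (2 * N)).map fun i => x (i + 1)).map transfer).prod).trace =
      ((((List.range (2 * N)).map b).map transfer).prod).trace := by
  have key : ∀ n, (((List.range (2 * n)).map fun i => x (i + 1)).map transfer).prod * gauge (u n) =
      gauge (u 0) * (((List.range (2 * n)).map b).map transfer).prod := by
    intro n
    induction n with
    | zero => simp
    | succ n ih =>
      rw [show 2 * (n + 1) = 2 * n + 1 + 1 by ring]
      simp only [List.range_succ, List.map_append, List.map_cons, List.map_nil, List.prod_append,
        List.prod_singleton]
      have h := transfer_gauge (h₁ n) (h₂ n) (h₃ n)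
      rw [mul_assoc _ (transfer _) (transfer _), mul_assoc, h, ← mul_assoc, ih]
      simp only [mul_assoc]
  have h := key N
  rw [hu] at h
  have h' : (((List.range (2 * N)).map fun i => x (i + 1)).map transfer).prod =
      gauge (u 0) * (((List.range (2 * N)).map b).map transfer).prod * gauge (-u 0) := by
    rw [← h, mul_assoc, gauge_mul_gauge_neg, mul_one]
  have hinv : gauge (-u 0) * gauge (u 0) = 1 := by
    simpa using gauge_mul_gauge_neg (-u 0)
  rw [h', Matrix.trace_mul_comm, ← mul_assoc, hinv, one_mul]

theorem coeff_prod_transfer_nil (p q : Bool) (k : ℕ) :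
    ((([] : List ℝ).map transfer).prod p q).coeff k = if p = q ∧ k = 0 then 1 else 0 := by
  by_cases h : p = q <;> simp [h, Polynomial.coeff_one]

/-- This is the recursion defining `PathSel`, with the existence of a selection replaced by a
weighted count. -/
theorem coeff_prod_transfer_cons (a : ℝ) (l : List ℝ) (p q : Bool) (k : ℕ) :
    (((a :: l).map transfer).prod p q).coeff k = ((l.map transfer).prod false q).coeff k +
      if p = false ∧ 0 < k then a * ((l.map transfer).prod true q).coeff (k - 1) else 0 := by
  rw [List.map_cons, List.prod_cons, Matrix.mul_apply, Fintype.sum_bool]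
  cases p
  · cases k with
    | zero => simp [transfer, mul_assoc]
    | succ k => simp [transfer, mul_assoc, Polynomial.coeff_X_mul, add_comm]
  · simp [transfer]

theorem coeff_prod_transfer_nonneg {l : List ℝ} (hl : ∀ x ∈ l, 0 ≤ x) (p q : Bool) (k : ℕ) :
    0 ≤ ((l.map transfer).prod p q).coeff k := by
  induction l generalizing p k with
  | nil =>
    rw [coeff_prod_transfer_nil]
    split_ifs <;> norm_num
  | cons a l ih =>
    have hl' : ∀ x ∈ l, 0 ≤ x := fun x hx => hl x (by simp [hx])
    rw [coeff_prod_transfer_cons]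
    have h1 := ih hl' false k
    have h2 := mul_nonneg (hl a (by simp)) (ih hl' true (k - 1))
    split_ifs <;> linarith

/-! ### Coefficients of the transfer product against minimal weights -/

section Estimates

variable {ι : Type*} {A b : ι → ℝ} {s c : ℝ}

/-- A single selection already contributes this much, since all other terms are nonnegative; each
entry costs at most one factor `c`. -/
theorem exp_le_coeff_prod_transfer (hc : 1 ≤ c) (hb : ∀ i, Real.exp (-(s * A i)) ≤ c * b i)
    {L : List ι} {p q : Bool} {k : ℕ} {w : ℝ} (h : PathSel (L.map A) p q k w) :
    Real.exp (-(s * w)) ≤ c ^ L.length * (((L.map b).map transfer).prod p q).coeff k := by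
  have hb0 : ∀ i, 0 ≤ b i := fun i => by
    have := (Real.exp_pos _).trans_le (hb i)
    exact (pos_of_mul_pos_right this (by linarith)).le
  have hb0' : ∀ L : List ι, ∀ x ∈ L.map b, 0 ≤ x := by
    intro L x hx
    obtain ⟨i, -, rfl⟩ := List.mem_map.1 hx
    exact hb0 i
  induction L generalizing p k w with
  | nil =>
    obtain ⟨rfl, rfl, rfl⟩ := h
    simp
  | cons i L ih =>
    rw [List.map_cons (f := b), coeff_prod_transfer_cons, List.length_cons, pow_succ', mul_assoc]
    have h1 := coeff_prod_transfer_nonneg (hb0' L) false q k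
    have h2 : 0 ≤ if p = false ∧ 0 < k then
        b i * (((L.map b).map transfer).prod true q).coeff (k - 1) else 0 := by
      split_ifs
      · exact mul_nonneg (hb0 i) (coeff_prod_transfer_nonneg (hb0' L) _ _ _)
      · exact le_rfl
    have hcn : 0 < c ^ L.length := by positivity
    rcases h with h | ⟨rfl, k', rfl, h⟩
    · refine (ih h).trans ?_
      refine (le_mul_of_one_le_left (by positivity) hc).trans ?_
      gcongr
      linarith
    · have h3 := ih h
      have h4 : Real.exp (-(s * w)) = Real.exp (-(s * A i)) * Real.exp (-(s * (w - A i))) := by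
        rw [← Real.exp_add]
        ring_nf
      rw [if_pos ⟨rfl, Nat.succ_pos _⟩, Nat.add_sub_cancel, h4]
      calc Real.exp (-(s * A i)) * Real.exp (-(s * (w - A i)))
          ≤ (c * b i) * (c ^ L.length * (((L.map b).map transfer).prod true q).coeff k') :=
            mul_le_mul (hb i) h3 (Real.exp_pos _).le
              (mul_nonneg (by linarith) (hb0 i))
        _ = c * (c ^ L.length * (b i * (((L.map b).map transfer).prod true q).coeff k')) := by
            ring
        _ ≤ _ := by
            gcongr
            linarith

/-- Every selection contributes at most the exponential of its minimal possible weight; the factor 2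
per entry counts the choices of selecting it or not. -/
theorem coeff_prod_transfer_le (hc : 1 ≤ c) (hs : 0 ≤ s) (hb0 : ∀ i, 0 ≤ b i)
    (hb : ∀ i, b i ≤ c * Real.exp (-(s * A i)))
    {L : List ι} {p q : Bool} {k : ℕ} {m : ℝ} (h : ∀ w, PathSel (L.map A) p q k w → m ≤ w) :
    (((L.map b).map transfer).prod p q).coeff k ≤ (2 * c) ^ L.length * Real.exp (-(s * m)) := by
  have hb0' : ∀ L : List ι, ∀ x ∈ L.map b, 0 ≤ x := by
    intro L x hx
    obtain ⟨i, -, rfl⟩ := List.mem_map.1 hx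
    exact hb0 i
  induction L generalizing p k m with
  | nil =>
    rw [List.map_nil, coeff_prod_transfer_nil]
    split_ifs with hpk
    · have := h 0 ⟨hpk.1, hpk.2, rfl⟩
      have : s * m ≤ 0 := mul_nonpos_of_nonneg_of_nonpos hs this
      simpa using this
    · positivity
  | cons i L ih =>
    rw [List.map_cons (f := b), coeff_prod_transfer_cons, List.length_cons]
    have h1 := ih (p := false) (k := k) (m := m) fun w hw => h w (Or.inl hw)
    have h2 : (if p = false ∧ 0 < k then
        b i * (((L.map b).map transfer).prod true q).coeff (k - 1) else 0) ≤
        c * ((2 * c) ^ L.length * Real.exp (-(s * m))) := by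
      split_ifs with hpk
      · have h3 := ih (p := true) (k := k - 1) (m := m - A i) fun w hw => by
          have := h (w + A i) (Or.inr ⟨hpk.1, k - 1, by omega, by simpa using hw⟩)
          linarith
        have h4 : Real.exp (-(s * m)) = Real.exp (-(s * A i)) * Real.exp (-(s * (m - A i))) := by
          rw [← Real.exp_add]
          ring_nf
        rw [h4]
        calc b i * (((L.map b).map transfer).prod true q).coeff (k - 1)
            ≤ (c * Real.exp (-(s * A i))) * ((2 * c) ^ L.length * Real.exp (-(s * (m - A i)))) :=
              mul_le_mul (hb i) h3 (coeff_prod_transfer_nonneg (hb0' L) _ _ _) (by positivity)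
          _ = _ := by ring
      · positivity
    have h5 : (2 * c) ^ L.length * Real.exp (-(s * m)) ≤
        c * ((2 * c) ^ L.length * Real.exp (-(s * m))) :=
      le_mul_of_one_le_left (by positivity) hc
    rw [pow_succ]
    linarith

theorem exp_le_coeff_trace (hc : 1 ≤ c) (hb : ∀ i, Real.exp (-(s * A i)) ≤ c * b i)
    {L : List ι} {k : ℕ} {w : ℝ} (h : CycSel (L.map A) k w) :
    Real.exp (-(s * w)) ≤ c ^ L.length * (((L.map b).map transfer).prod.trace).coeff k := by
  have hb0 : ∀ x ∈ L.map b, 0 ≤ x := by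
    intro x hx
    obtain ⟨i, -, rfl⟩ := List.mem_map.1 hx
    have := (Real.exp_pos _).trans_le (hb i)
    exact (pos_of_mul_pos_right this (by linarith)).le
  obtain ⟨p, h⟩ := h
  refine (exp_le_coeff_prod_transfer hc hb h).trans ?_
  rw [Matrix.trace, Fintype.sum_bool, Polynomial.coeff_add]
  have h1 := coeff_prod_transfer_nonneg hb0 true true k
  have h2 := coeff_prod_transfer_nonneg hb0 false false k
  simp only [Matrix.diag_apply]
  gcongr
  cases p <;> linarith

theorem coeff_trace_le (hc : 1 ≤ c) (hs : 0 ≤ s) (hb0 : ∀ i, 0 ≤ b i)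
    (hb : ∀ i, b i ≤ c * Real.exp (-(s * A i)))
    {L : List ι} {k : ℕ} {m : ℝ} (h : ∀ w, CycSel (L.map A) k w → m ≤ w) :
    (((L.map b).map transfer).prod.trace).coeff k ≤
      2 * (2 * c) ^ L.length * Real.exp (-(s * m)) := by
  rw [Matrix.trace, Fintype.sum_bool, Polynomial.coeff_add]
  have h1 := coeff_prod_transfer_le hc hs hb0 hb (p := true) (q := true) (L := L)
    fun w hw => h w ⟨_, hw⟩
  have h2 := coeff_prod_transfer_le hc hs hb0 hb (p := false) (q := false) (L := L)
    fun w hw => h w ⟨_, hw⟩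
  simp only [Matrix.diag_apply]
  linarith

end Estimates

/-- If `w < m`, then `exp (s * (m - w))` would stay below `C` for all large `s`. -/
theorem le_of_forall_exp_le {m w C : ℝ}
    (h : ∀ s, 1 ≤ s → Real.exp (-(s * w)) ≤ C * Real.exp (-(s * m))) : m ≤ w := by
  by_contra! hlt
  have hd : 0 < m - w := by linarith
  have key : ∀ s, 1 ≤ s → s * (m - w) + 1 ≤ C := by
    intro s hs
    refine (Real.add_one_le_exp _).trans ?_
    have h1 : Real.exp (s * (m - w)) = Real.exp (-(s * w)) * Real.exp (s * m) := by
      rw [← Real.exp_add]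
      ring_nf
    rw [h1]
    refine (mul_le_mul_of_nonneg_right (h s hs) (Real.exp_pos _).le).trans_eq ?_
    rw [mul_assoc, ← Real.exp_add]
    simp
  have h2 := key (max 1 (C / (m - w))) (le_max_left _ _)
  have h3 : C ≤ max 1 (C / (m - w)) * (m - w) := by
    rw [← div_le_iff₀ hd]
    exact le_max_right _ _
  linarith

/-! ### The time evolution -/

theorem sum_range_periodic {N : ℕ} {h : ℕ → ℝ} (hh : ∀ i, h (i + N) = h i) (n : ℕ) :
    ∑ i ∈ Finset.range N, h (n + i) = ∑ i ∈ Finset.range N, h i := by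
  induction n with
  | zero => simp
  | succ n ih =>
    have h1 := Finset.sum_range_succ (fun i => h (n + i)) N
    rw [Finset.sum_range_succ', add_zero, hh] at h1
    rw [← ih, ← add_right_cancel h1]
    exact Finset.sum_congr rfl fun i _ => by rw [show n + 1 + i = n + (i + 1) by ring]

variable {N : ℕ} {A : ZMod (2 * N) → ℝ}

theorem two_mul_natCast_self (N : ℕ) : 2 * (N : ZMod (2 * N)) = 0 := by
  exact_mod_cast ZMod.natCast_self (2 * N)

/-- The sum over the even indices. -/
noncomputable def evenSum (N : ℕ) (f : ZMod (2 * N) → ℝ) : ℝ :=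
  ∑ i ∈ Finset.range N, f (2 * (i : ZMod (2 * N)))

theorem evenSum_shift (f : ZMod (2 * N) → ℝ) (n : ℕ) :
    ∑ i ∈ Finset.range N, f (2 * ((n + i : ℕ) : ZMod (2 * N))) = evenSum N f := by
  refine sum_range_periodic (h := fun i => f (2 * (i : ZMod (2 * N)))) (fun i => ?_) n
  simp only [Nat.cast_add, mul_add, two_mul_natCast_self, add_zero]

theorem evenSum_add_two (f : ZMod (2 * N) → ℝ) : evenSum N (fun j => f (j + 2)) = evenSum N f := by
  rw [← evenSum_shift f 1]
  refine Finset.sum_congr rfl fun i _ => ?_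
  change f (_ + 2) = f _
  congr 1
  push_cast
  ring

theorem isState_iff (N : ℕ) (A : ZMod (2 * N) → ℝ) :
    IsState N A ↔ (∀ j, 0 < A j) ∧ evenSum N A < evenSum N fun j => A (j + 1) := by
  have h1 : ∑ l ∈ Finset.Icc 1 N, A (2 * (l : ZMod (2 * N))) = evenSum N A := by
    rw [sum_Icc_one (fun l => A (2 * (l : ZMod (2 * N)))), ← evenSum_shift A 1]
    simp only [add_comm]
  have h2 : ∑ l ∈ Finset.Icc 1 N, A (2 * (l : ZMod (2 * N)) - 1) =
      evenSum N fun j => A (j + 1) := by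
    rw [sum_Icc_one (fun l => A (2 * (l : ZMod (2 * N)) - 1))]
    refine Finset.sum_congr rfl fun i _ => ?_
    congr 1
    push_cast
    ring
  exact ⟨fun h => ⟨h.pos, by rw [← h1, ← h2]; exact h.phase⟩,
    fun h => ⟨h.1, by rw [h1, h2]; exact h.2⟩⟩

/-- The sum `∑_{l=1}^k (A_{j-2l+1} - A_{j-2l})`. -/
noncomputable def backSum (A : ZMod (2 * N) → ℝ) (k : ℕ) (j : ZMod (2 * N)) : ℝ :=
  ∑ i ∈ Finset.range k,
    (A (j - 2 * ((i + 1 : ℕ) : ZMod (2 * N)) + 1) - A (j - 2 * ((i + 1 : ℕ) : ZMod (2 * N))))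

/-- The minimum of the sums `∑_{l=1}^k (A_{j-2l+1} - A_{j-2l})` for `0 ≤ k ≤ N - 1`. -/
noncomputable def backMin (A : ZMod (2 * N) → ℝ) (j : ZMod (2 * N)) : ℝ :=
  (Finset.Icc 0 (N - 1)).inf' ⟨0, by simp⟩ fun k => backSum A k j

theorem evolveEven_eq (A : ZMod (2 * N) → ℝ) (j : ZMod (2 * N)) :
    evolveEven N A j = min (A (j + 1)) (A j - backMin A j) := by
  rw [evolveEven, backMin]
  congr 3
  funext k
  exact sum_Icc_one (fun l => A (j - 2 * (l : ZMod (2 * N)) + 1) - A (j - 2 * (l : ZMod (2 * N))))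
    k

theorem backMin_le {k : ℕ} (hk : k < N) (j : ZMod (2 * N)) : backMin A j ≤ backSum A k j :=
  Finset.inf'_le _ (by simp only [Finset.mem_Icc]; omega)

theorem exists_backMin_eq (hN : 1 ≤ N) (A : ZMod (2 * N) → ℝ) (j : ZMod (2 * N)) :
    ∃ k < N, backMin A j = backSum A k j := by
  obtain ⟨k, hk, h⟩ := Finset.exists_mem_eq_inf' (s := Finset.Icc 0 (N - 1)) ⟨0, by simp⟩
    fun k => backSum A k j
  simp only [Finset.mem_Icc] at hk
  exact ⟨k, by omega, h⟩

theorem backSum_succ (A : ZMod (2 * N) → ℝ) (k : ℕ) (j : ZMod (2 * N)) :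
    backSum A (k + 1) (j + 2) = A (j + 1) - A j + backSum A k j := by
  have h : ∀ i : ℕ, j + 2 - 2 * ((i + 1 : ℕ) : ZMod (2 * N)) = j - 2 * (i : ZMod (2 * N)) :=
    fun i => by push_cast; ring
  rw [backSum, backSum, Finset.sum_range_succ']
  simp only [h, Nat.cast_zero, mul_zero, sub_zero]
  ring

theorem backSum_full (A : ZMod (2 * N) → ℝ) (n : ℕ) :
    backSum A N (2 * (n : ZMod (2 * N))) = evenSum N (fun j => A (j + 1)) - evenSum N A := by
  rw [backSum, ← Finset.sum_range_reflect, ← evenSum_shift A n,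
    ← evenSum_shift (fun j => A (j + 1)) n, ← Finset.sum_sub_distrib]
  refine Finset.sum_congr rfl fun i hi => ?_
  have hi' := Finset.mem_range.1 hi
  have h : 2 * (n : ZMod (2 * N)) - 2 * ((N - 1 - i + 1 : ℕ) : ZMod (2 * N)) =
      2 * ((n + i : ℕ) : ZMod (2 * N)) := by
    rw [show N - 1 - i + 1 = N - i by omega, Nat.cast_sub hi'.le, mul_sub, two_mul_natCast_self]
    push_cast
    ring
  rw [h]

/-- The sums at `j + 2` are zero or extend those at `j` by one term. Only the sum over the full
period falls outside the range of the minimum. -/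
theorem backMin_add_two (hN : 1 ≤ N) (hA : IsState N A) (n : ℕ) :
    backMin A (2 * (n : ZMod (2 * N)) + 2) =
      min 0 (A (2 * (n : ZMod (2 * N)) + 1) - A (2 * (n : ZMod (2 * N))) +
        backMin A (2 * (n : ZMod (2 * N)))) := by
  have h0 : backMin A (2 * (n : ZMod (2 * N)) + 2) ≤ 0 := by
    simpa [backSum] using backMin_le (A := A) (k := 0) hN (2 * (n : ZMod (2 * N)) + 2)
  apply le_antisymm
  · refine le_min h0 ?_
    obtain ⟨k, hk, h⟩ := exists_backMin_eq hN A (2 * (n : ZMod (2 * N)))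
    rw [h, ← backSum_succ]
    rcases Nat.lt_or_ge (k + 1) N with hk' | hk'
    · exact backMin_le hk' _
    -- The full-period sum is positive by the phase condition, hence above the bound zero.
    · obtain rfl : N = k + 1 := by omega
      have h1 := backSum_full A (n + 1)
      push_cast at h1
      rw [mul_add, mul_one] at h1
      rw [h1]
      have := ((isState_iff _ A).1 hA).2
      linarith
  · obtain ⟨k, hk, h⟩ := exists_backMin_eq hN A (2 * (n : ZMod (2 * N)) + 2)
    rw [h]
    cases k with
    | zero => simp [backSum]
    | succ k =>
      rw [backSum_succ]
      have := backMin_le (A := A) (k := k) (by omega) (2 * (n : ZMod (2 * N)))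
      exact (min_le_right _ _).trans (by linarith)

/-- With the tropical carrier `A j - backMin A j`, the new value differs from `A (j + 2)` by a
difference of carriers, so summing over a period preserves the even sum. -/
theorem evolveEven_add (hN : 1 ≤ N) (hA : IsState N A) (n : ℕ) :
    evolveEven N A (2 * (n : ZMod (2 * N))) =
      A (2 * (n : ZMod (2 * N)) + 2) +
        (A (2 * (n : ZMod (2 * N))) - backMin A (2 * (n : ZMod (2 * N)))) -
        (A (2 * (n : ZMod (2 * N)) + 2) - backMin A (2 * (n : ZMod (2 * N)) + 2)) := by
  rw [evolveEven_eq, backMin_add_two hN hA]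
  rcases le_total (A (2 * (n : ZMod (2 * N)) + 1))
    (A (2 * (n : ZMod (2 * N))) - backMin A (2 * (n : ZMod (2 * N)))) with h | h
  · rw [min_eq_left h, min_eq_right (by linarith)]
    ring
  · rw [min_eq_right h, min_eq_left (by linarith)]
    ring

theorem even_val_natCast (N i : ℕ) :
    Even (i : ZMod (2 * N)).val ↔ Even i := by
  rw [ZMod.val_natCast, Nat.even_iff, Nat.even_iff, Nat.mod_mod_of_dvd _ (dvd_mul_right 2 N)]

theorem evolve_natCast (A : ZMod (2 * N) → ℝ) (i : ℕ) :
    evolve N A (i : ZMod (2 * N)) = if Even i then evolveEven N A i else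
      A i + A (i + 1) - evolveEven N A (i - 1) := by
  simp only [evolve, even_val_natCast N i]

theorem evolveEven_pos (hN : 1 ≤ N) (hA : ∀ j, 0 < A j) (j : ZMod (2 * N)) :
    0 < evolveEven N A j := by
  rw [evolveEven_eq]
  have : backMin A j ≤ 0 := by simpa [backSum] using backMin_le (A := A) (k := 0) hN j
  exact lt_min (hA _) (by linarith [hA j])

theorem evolve_isState (hN : 1 ≤ N) (hA : IsState N A) : IsState N (evolve N A) := by
  have hp := hA.pos
  rw [isState_iff]
  constructor
  · intro j
    rw [evolve]
    split_ifs
    · exact evolveEven_pos hN hp j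
    · have h1 : evolveEven N A (j - 1) ≤ A j := by
        rw [evolveEven_eq, sub_add_cancel]
        exact min_le_left _ _
      linarith [hp (j + 1)]
  · have h1 : evenSum N (evolveEven N A) = evenSum N A := by
      have h : evenSum N (evolveEven N A) = evenSum N fun j =>
          A (j + 2) + (A j - backMin A j) - (A (j + 2) - backMin A (j + 2)) :=
        Finset.sum_congr rfl fun i _ => evolveEven_add hN hA i
      have h2 := evenSum_add_two (fun j => A j - backMin A j)
      have h3 := evenSum_add_two A
      rw [h]
      simp only [evenSum, Finset.sum_add_distrib, Finset.sum_sub_distrib] at h2 h3 ⊢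
      linarith
    have h2 : evenSum N (evolve N A) = evenSum N (evolveEven N A) := by
      refine Finset.sum_congr rfl fun i _ => ?_
      have := evolve_natCast A (2 * i)
      rw [if_pos (even_two_mul i)] at this
      exact_mod_cast this
    have h3 : (evenSum N fun j => evolve N A (j + 1)) =
        evenSum N fun j => A (j + 1) + A (j + 2) - evolveEven N A j := by
      refine Finset.sum_congr rfl fun i _ => ?_
      have := evolve_natCast A (2 * i + 1)
      rw [if_neg (by simp)] at this
      push_cast at this
      rw [add_sub_cancel_right, add_assoc _ 1 1, one_add_one_eq_two] at this
      exact this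
    have h4 := evenSum_add_two A
    have h5 := ((isState_iff N A).1 hA).2
    rw [h3, h2, h1]
    simp only [evenSum, Finset.sum_add_distrib, Finset.sum_sub_distrib] at h1 h4 h5 ⊢
    linarith

theorem evolve_iterate_isState (hN : 1 ≤ N) (hA : IsState N A) (t : ℕ) :
    IsState N ((evolve N)^[t] A) := by
  induction t with
  | zero => exact hA
  | succ t ih =>
    rw [Function.iterate_succ_apply']
    exact evolve_isState hN ih

/-- The partial sums `F` grow by `F N ≥ 0` over each period, so a minimum over one period is a
global minimum, and the shift starting there has nonnegative partial sums. -/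
theorem exists_highestWeight (hN : 1 ≤ N) (hA : IsState N A) :
    ∃ n : ZMod (2 * N), HighestWeight N (shift N n A) := by
  set d : ℕ → ℝ := fun i => A (2 * (i : ZMod (2 * N)) + 1) - A (2 * (i : ZMod (2 * N)) + 2) with hd
  set F : ℕ → ℝ := fun n => ∑ i ∈ Finset.range n, d i with hF
  have hper : ∀ i, d (i + N) = d i := by
    intro i
    simp only [hd, Nat.cast_add, mul_add, two_mul_natCast_self, add_zero]
  have hFN : 0 ≤ F N := by
    have h1 := ((isState_iff N A).1 hA).2
    have h2 := evenSum_add_two A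
    simp only [evenSum] at h1 h2
    simp only [hF, hd, Finset.sum_sub_distrib]
    linarith
  have hFadd : ∀ n, F (n + N) = F n + F N := by
    intro n
    simp only [hF]
    rw [Finset.sum_range_add, sum_range_periodic hper]
  obtain ⟨n, -, hn⟩ := Finset.exists_min_image (Finset.range N) F ⟨0, Finset.mem_range.2 hN⟩
  have hmin : ∀ m, F n ≤ F m := by
    intro m
    induction m using Nat.strong_induction_on with
    | _ m ih =>
    rcases Nat.lt_or_ge m N with h | h
    · exact hn m (Finset.mem_range.2 h)
    · have h1 := ih (m - N) (by omega)
      have h2 := hFadd (m - N)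
      rw [Nat.sub_add_cancel h] at h2
      linarith
  refine ⟨n, fun k _ => ?_⟩
  rw [sum_Icc_one (fun i => shift N n A (2 * (i : ZMod (2 * N)) - 1) -
    shift N n A (2 * (i : ZMod (2 * N))))]
  have h1 : ∑ i ∈ Finset.range k, (shift N n A (2 * ((i + 1 : ℕ) : ZMod (2 * N)) - 1) -
      shift N n A (2 * ((i + 1 : ℕ) : ZMod (2 * N)))) = F (n + k) - F n := by
    simp only [hF]
    rw [Finset.sum_range_add, add_sub_cancel_left]
    refine Finset.sum_congr rfl fun i _ => ?_
    simp only [shift, hd]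
    congr 2 <;> push_cast <;> ring
  rw [h1]
  linarith [hmin (n + k)]

/-! ### The evolution as a limit of the discrete Toda lattice -/

section Lift

variable (A) (s : ℝ)

/-- The variables of the discrete Toda lattice. -/
noncomputable def lift (j : ZMod (2 * N)) : ℝ := Real.exp (-(s * A j))

/-- The sum of the exponentials of `-s ∑_{l=1}^k (A_{j-2l+1} - A_{j-2l})`. -/
noncomputable def liftSum (j : ZMod (2 * N)) : ℝ :=
  ∑ k ∈ Finset.range N, Real.exp (-(s * backSum A k j))

/-- The factor `1 - ∏ V / ∏ I` of the discrete Toda lattice. -/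
noncomputable def liftGap : ℝ := 1 - Real.exp (-(s * (evenSum N (fun j => A (j + 1)) - evenSum N A)))

/-- The auxiliary variables which carry the evolution of the discrete Toda lattice. -/
noncomputable def carrier (j : ZMod (2 * N)) : ℝ := liftGap A s * lift A s j / liftSum A s j

/-- The evolved variables of the discrete Toda lattice at even indices. -/
noncomputable def liftEven (j : ZMod (2 * N)) : ℝ := carrier A s j + lift A s (j + 1)

/-- The evolved variables of the discrete Toda lattice. -/
noncomputable def liftEvolve (i : ℕ) : ℝ :=
  if Even i then liftEven A s (i : ZMod (2 * N)) else
    lift A s (i : ZMod (2 * N)) * lift A s ((i : ZMod (2 * N)) + 1) /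
      liftEven A s ((i : ZMod (2 * N)) - 1)

variable {A s}

theorem lift_pos (j : ZMod (2 * N)) : 0 < lift A s j := Real.exp_pos _

theorem liftSum_pos (hN : 1 ≤ N) (j : ZMod (2 * N)) : 0 < liftSum A s j :=
  Finset.sum_pos (fun _ _ => Real.exp_pos _) ⟨0, Finset.mem_range.2 hN⟩

theorem liftGap_pos (hA : IsState N A) (hs : 1 ≤ s) : 0 < liftGap A s := by
  have h := ((isState_iff N A).1 hA).2
  have : 0 < s * (evenSum N (fun j => A (j + 1)) - evenSum N A) :=
    mul_pos (by linarith) (by linarith)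
  rw [liftGap]
  have := Real.exp_lt_one_iff.2 (neg_lt_zero.2 this)
  linarith

theorem carrier_pos (hN : 1 ≤ N) (hA : IsState N A) (hs : 1 ≤ s) (j : ZMod (2 * N)) :
    0 < carrier A s j :=
  div_pos (mul_pos (liftGap_pos hA hs) (lift_pos j)) (liftSum_pos hN j)

theorem liftEven_pos (hN : 1 ≤ N) (hA : IsState N A) (hs : 1 ≤ s) (j : ZMod (2 * N)) :
    0 < liftEven A s j :=
  add_pos (carrier_pos hN hA hs j) (lift_pos _)

/-- Passing from `j` to `j + 2` shifts the summation index by one: the term 1 enters, the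
full-period term leaves, and `liftGap` is their difference. -/
theorem liftSum_add_two (n : ℕ) :
    lift A s (2 * (n : ZMod (2 * N))) * liftSum A s (2 * (n : ZMod (2 * N)) + 2) =
      liftGap A s * lift A s (2 * (n : ZMod (2 * N))) +
        lift A s (2 * (n : ZMod (2 * N)) + 1) * liftSum A s (2 * (n : ZMod (2 * N))) := by
  have h1 := Finset.sum_range_succ
    (fun k => Real.exp (-(s * backSum A k (2 * (n : ZMod (2 * N)) + 2)))) N
  rw [Finset.sum_range_succ'] at h1
  have h2 := backSum_full A (n + 1)
  push_cast at h2
  rw [mul_add, mul_one] at h2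
  have h3 : ∀ k, lift A s (2 * (n : ZMod (2 * N))) *
      Real.exp (-(s * backSum A (k + 1) (2 * (n : ZMod (2 * N)) + 2))) =
      lift A s (2 * (n : ZMod (2 * N)) + 1) *
        Real.exp (-(s * backSum A k (2 * (n : ZMod (2 * N))))) := by
    intro k
    rw [backSum_succ, lift, lift, ← Real.exp_add, ← Real.exp_add]
    ring_nf
  have h4 : lift A s (2 * (n : ZMod (2 * N)) + 1) * liftSum A s (2 * (n : ZMod (2 * N))) =
      lift A s (2 * (n : ZMod (2 * N))) * ∑ k ∈ Finset.range N,
        Real.exp (-(s * backSum A (k + 1) (2 * (n : ZMod (2 * N)) + 2))) := by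
    rw [liftSum, Finset.mul_sum, Finset.mul_sum]
    exact Finset.sum_congr rfl fun k _ => (h3 k).symm
  have h5 : Real.exp (-(s * backSum A 0 (2 * (n : ZMod (2 * N)) + 2))) = 1 := by simp [backSum]
  rw [h4, liftGap, ← h2, liftSum]
  rw [h5] at h1
  linear_combination (-lift A s (2 * (n : ZMod (2 * N)))) * h1

/-- The multiplicative counterpart of `evolveEven_add`; both carrier equations required by
`trace_prod_transfer_eq` follow from it. -/
theorem carrier_add_two (hN : 1 ≤ N) (n : ℕ) :
    carrier A s (2 * (n : ZMod (2 * N)) + 2) * liftEven A s (2 * (n : ZMod (2 * N))) =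
      carrier A s (2 * (n : ZMod (2 * N))) * lift A s (2 * (n : ZMod (2 * N)) + 2) := by
  have h1 := (liftSum_pos (A := A) (s := s) hN (2 * (n : ZMod (2 * N)))).ne'
  have h2 := (liftSum_pos (A := A) (s := s) hN (2 * (n : ZMod (2 * N)) + 2)).ne'
  have h := liftSum_add_two (A := A) (s := s) n
  rw [liftEven, carrier, carrier]
  field_simp
  linear_combination (-(liftGap A s * lift A s (2 * (n : ZMod (2 * N)) + 2))) * h

/-- The old variables are listed from index 1 and the new ones from index 0, because one local step
turns the pair at `2n + 1, 2n + 2` into the pair at `2n, 2n + 1`. -/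
theorem trace_lift_eq (hN : 1 ≤ N) (hA : IsState N A) (hs : 1 ≤ s) :
    ((((List.range (2 * N)).map fun i : ℕ => lift A s ((i + 1 : ℕ) : ZMod (2 * N))).map
      transfer).prod).trace =
      ((((List.range (2 * N)).map (liftEvolve A s)).map transfer).prod).trace := by
  have he : ∀ n : ℕ, liftEvolve A s (2 * n) = liftEven A s (2 * (n : ZMod (2 * N))) := by
    intro n
    rw [liftEvolve, if_pos (even_two_mul n)]
    push_cast
    rfl
  have ho : ∀ n : ℕ, liftEvolve A s (2 * n + 1) = lift A s (2 * (n : ZMod (2 * N)) + 1) *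
      lift A s (2 * (n : ZMod (2 * N)) + 2) / liftEven A s (2 * (n : ZMod (2 * N))) := by
    intro n
    rw [liftEvolve, if_neg (by simp)]
    push_cast
    rw [add_sub_cancel_right, add_assoc, one_add_one_eq_two]
  refine trace_prod_transfer_eq (x := fun i : ℕ => lift A s (i : ZMod (2 * N)))
    (u := fun n : ℕ => carrier A s (2 * (n : ZMod (2 * N)))) N (fun n => ?_) (fun n => ?_)
    (fun n => ?_) ?_
  · rw [he, liftEven]
    push_cast
    rfl
  · have h := carrier_add_two (A := A) (s := s) hN n
    have hp := (liftEven_pos hN hA hs (2 * (n : ZMod (2 * N)))).ne'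
    rw [ho]
    push_cast
    rw [mul_add, mul_one]
    field_simp
    rw [h, liftEven]
    ring
  · have h := carrier_add_two (A := A) (s := s) hN n
    have hp := (liftEven_pos hN hA hs (2 * (n : ZMod (2 * N)))).ne'
    rw [ho]
    push_cast
    rw [mul_add, mul_one]
    field_simp
    linear_combination (-lift A s (2 * (n : ZMod (2 * N)) + 1)) * h
  · simp [two_mul_natCast_self]

end Lift

/-! ### Bounds for the lifted evolution, uniform in the parameter -/

variable {s : ℝ}

theorem liftGap_le_one : liftGap A s ≤ 1 := by
  rw [liftGap]
  linarith [Real.exp_pos (-(s * (evenSum N (fun j => A (j + 1)) - evenSum N A)))]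

theorem liftGap_one_le (hA : IsState N A) (hs : 1 ≤ s) : liftGap A 1 ≤ liftGap A s := by
  have h := ((isState_iff N A).1 hA).2
  have h1 : 1 * (evenSum N (fun j => A (j + 1)) - evenSum N A) ≤
      s * (evenSum N (fun j => A (j + 1)) - evenSum N A) :=
    mul_le_mul_of_nonneg_right hs (by linarith)
  rw [liftGap, liftGap]
  have := Real.exp_le_exp.2 (neg_le_neg h1)
  linarith

theorem exp_backMin_le_liftSum (hN : 1 ≤ N) (j : ZMod (2 * N)) :
    Real.exp (-(s * backMin A j)) ≤ liftSum A s j := by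
  obtain ⟨k, hk, h⟩ := exists_backMin_eq hN A j
  rw [h]
  exact Finset.single_le_sum (f := fun k => Real.exp (-(s * backSum A k j)))
    (fun _ _ => (Real.exp_pos _).le) (Finset.mem_range.2 hk)

theorem liftSum_le (hs : 0 ≤ s) (j : ZMod (2 * N)) :
    liftSum A s j ≤ N * Real.exp (-(s * backMin A j)) := by
  refine (Finset.sum_le_card_nsmul _ _ (Real.exp (-(s * backMin A j))) fun k hk => ?_).trans_eq
    (by simp)
  exact Real.exp_le_exp.2
    (neg_le_neg (mul_le_mul_of_nonneg_left (backMin_le (Finset.mem_range.1 hk) j) hs))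

theorem lift_eq_mul (j : ZMod (2 * N)) :
    lift A s j = Real.exp (-(s * (A j - backMin A j))) * Real.exp (-(s * backMin A j)) := by
  rw [lift, ← Real.exp_add]
  ring_nf

theorem carrier_le (hN : 1 ≤ N) (j : ZMod (2 * N)) :
    carrier A s j ≤ Real.exp (-(s * (A j - backMin A j))) := by
  rw [carrier, div_le_iff₀ (liftSum_pos hN j), lift_eq_mul]
  have h1 := exp_backMin_le_liftSum (A := A) (s := s) hN j
  calc liftGap A s * (Real.exp (-(s * (A j - backMin A j))) * Real.exp (-(s * backMin A j)))
      ≤ 1 * (Real.exp (-(s * (A j - backMin A j))) * liftSum A s j) :=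
        mul_le_mul liftGap_le_one (by gcongr) (by positivity) zero_le_one
    _ = _ := one_mul _

/-- The factor `N` bounds a sum of exponentials by its largest term, and the gap at `s = 1` is a
lower bound for all `s ≥ 1`; the constant is therefore independent of `s`. -/
theorem le_carrier (hN : 1 ≤ N) (hA : IsState N A) (hs : 1 ≤ s) (j : ZMod (2 * N)) :
    Real.exp (-(s * (A j - backMin A j))) ≤ N / liftGap A 1 * carrier A s j := by
  have hg := liftGap_pos hA le_rfl
  have hg' := liftGap_one_le hA hs
  have h1 := liftSum_le (A := A) (by linarith : 0 ≤ s) j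
  rw [carrier, div_mul_div_comm, le_div_iff₀ (mul_pos hg (liftSum_pos hN j)), lift_eq_mul]
  calc Real.exp (-(s * (A j - backMin A j))) * (liftGap A 1 * liftSum A s j)
      ≤ Real.exp (-(s * (A j - backMin A j))) *
        (liftGap A s * (N * Real.exp (-(s * backMin A j)))) := by
        gcongr
        · exact (liftSum_pos hN j).le
        · exact hg.le.trans hg'
    _ = _ := by ring

theorem exp_mul_min (hs : 0 ≤ s) (a b : ℝ) :
    Real.exp (-(s * min a b)) = max (Real.exp (-(s * a))) (Real.exp (-(s * b))) := by
  rcases le_total a b with h | h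
  · rw [min_eq_left h, max_eq_left]
    exact Real.exp_le_exp.2 (neg_le_neg (mul_le_mul_of_nonneg_left h hs))
  · rw [min_eq_right h, max_eq_right]
    exact Real.exp_le_exp.2 (neg_le_neg (mul_le_mul_of_nonneg_left h hs))

theorem one_le_div_liftGap (hN : 1 ≤ N) (hA : IsState N A) : 1 ≤ N / liftGap A 1 := by
  rw [one_le_div (liftGap_pos hA le_rfl)]
  have : (1 : ℝ) ≤ N := by exact_mod_cast hN
  exact liftGap_le_one.trans this

theorem liftEven_le (hN : 1 ≤ N) (hs : 1 ≤ s) (j : ZMod (2 * N)) :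
    liftEven A s j ≤ 2 * Real.exp (-(s * evolveEven N A j)) := by
  rw [evolveEven_eq, exp_mul_min (by linarith), liftEven]
  have h1 := carrier_le (A := A) (s := s) hN j
  have h2 := le_max_left (Real.exp (-(s * A (j + 1)))) (Real.exp (-(s * (A j - backMin A j))))
  have h3 := le_max_right (Real.exp (-(s * A (j + 1)))) (Real.exp (-(s * (A j - backMin A j))))
  rw [lift]
  linarith

theorem le_liftEven (hN : 1 ≤ N) (hA : IsState N A) (hs : 1 ≤ s) (j : ZMod (2 * N)) :
    Real.exp (-(s * evolveEven N A j)) ≤ N / liftGap A 1 * liftEven A s j := by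
  have hc := one_le_div_liftGap hN hA
  have h1 := le_carrier hN hA hs j
  have h2 := carrier_pos hN hA hs j
  have h3 := lift_pos (A := A) (s := s) (j + 1)
  have h4 : lift A s (j + 1) ≤ N / liftGap A 1 * lift A s (j + 1) :=
    le_mul_of_one_le_left h3.le hc
  have h5 : 0 < N / liftGap A 1 * carrier A s j := mul_pos (by linarith) h2
  rw [evolveEven_eq, exp_mul_min (by linarith), liftEven, mul_add]
  refine max_le ?_ (by linarith)
  change lift A s (j + 1) ≤ _
  linarith

theorem liftEvolve_pos (hN : 1 ≤ N) (hA : IsState N A) (hs : 1 ≤ s) (i : ℕ) :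
    0 < liftEvolve A s i := by
  rw [liftEvolve]
  split_ifs
  · exact liftEven_pos hN hA hs _
  · exact div_pos (mul_pos (lift_pos _) (lift_pos _)) (liftEven_pos hN hA hs _)

theorem exp_evolve_odd (x y b : ℝ) :
    Real.exp (-(s * (x + y - b))) * Real.exp (-(s * b)) =
      Real.exp (-(s * x)) * Real.exp (-(s * y)) := by
  rw [← Real.exp_add, ← Real.exp_add]
  ring_nf

/-- At odd indices the even variable is in the denominator, so the upper bound here rests on the
lower bound `le_liftEven`, and conversely in `le_liftEvolve`. -/
theorem liftEvolve_le (hN : 1 ≤ N) (hA : IsState N A) (hs : 1 ≤ s) (i : ℕ) :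
    liftEvolve A s i ≤
      2 * (N / liftGap A 1) * Real.exp (-(s * evolve N A (i : ZMod (2 * N)))) := by
  have hc := one_le_div_liftGap hN hA
  rw [liftEvolve, evolve_natCast]
  split_ifs with hi
  · refine (liftEven_le (A := A) hN hs _).trans ?_
    gcongr
    linarith
  · rw [div_le_iff₀ (liftEven_pos hN hA hs _), lift, lift, ← exp_evolve_odd (s := s) _ _
      (evolveEven N A ((i : ZMod (2 * N)) - 1))]
    have h1 := le_liftEven hN hA hs ((i : ZMod (2 * N)) - 1)
    have h2 := (Real.exp_pos (-(s * evolveEven N A ((i : ZMod (2 * N)) - 1)))).trans_le h1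
    calc _ ≤ Real.exp (-(s * (A i + A (i + 1) - evolveEven N A ((i : ZMod (2 * N)) - 1)))) *
          (2 * (N / liftGap A 1 * liftEven A s ((i : ZMod (2 * N)) - 1))) := by
          gcongr
          linarith
      _ = _ := by ring

theorem le_liftEvolve (hN : 1 ≤ N) (hA : IsState N A) (hs : 1 ≤ s) (i : ℕ) :
    Real.exp (-(s * evolve N A (i : ZMod (2 * N)))) ≤
      2 * (N / liftGap A 1) * liftEvolve A s i := by
  have hc := one_le_div_liftGap hN hA
  rw [liftEvolve, evolve_natCast]
  split_ifs with hi
  · refine (le_liftEven hN hA hs _).trans ?_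
    have := liftEven_pos hN hA hs (i : ZMod (2 * N))
    gcongr
    linarith
  · have hp := liftEven_pos hN hA hs ((i : ZMod (2 * N)) - 1)
    rw [← mul_div_assoc, le_div_iff₀ hp, lift, lift, ← exp_evolve_odd (s := s) _ _
      (evolveEven N A ((i : ZMod (2 * N)) - 1))]
    have h1 := liftEven_le (A := A) hN hs ((i : ZMod (2 * N)) - 1)
    have h2 := Real.exp_pos (-(s * evolveEven N A ((i : ZMod (2 * N)) - 1)))
    have h3 : 2 * Real.exp (-(s * evolveEven N A ((i : ZMod (2 * N)) - 1))) ≤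
        N / liftGap A 1 * (2 * Real.exp (-(s * evolveEven N A ((i : ZMod (2 * N)) - 1)))) :=
      le_mul_of_one_le_left (by positivity) hc
    calc _ ≤ Real.exp (-(s * (A i + A (i + 1) - evolveEven N A ((i : ZMod (2 * N)) - 1)))) *
          (N / liftGap A 1 * (2 * Real.exp (-(s * evolveEven N A ((i : ZMod (2 * N)) - 1))))) := by
          gcongr
          linarith
      _ = _ := by ring

/-! ### Conservation of the minimal weights -/

theorem cycSel_toArray_range (B : ZMod (2 * N) → ℝ) (k : ℕ) (w : ℝ) :
    CycSel (toArray N B) k w ↔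
      CycSel ((List.range (2 * N)).map fun i : ℕ => B (i : ZMod (2 * N))) k w := by
  rw [toArray]
  refine cycSel_rotate (g := fun i : ℕ => B (i : ZMod (2 * N))) (fun i => ?_) k w
  rw [Nat.cast_add, ZMod.natCast_self, add_zero]

/-- The common trace coefficient is bounded below by the selection of weight `w` before the step and
above by the lower bound `m` after it; `le_of_forall_exp_le` compares the exponents. -/
theorem evolve_lowerBound (hN : 1 ≤ N) (hA : IsState N A) {k : ℕ} {m w : ℝ}
    (hm : ∀ v, CycSel (toArray N (evolve N A)) k v → m ≤ v) (hw : CycSel (toArray N A) k w) :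
    m ≤ w := by
  have hc := one_le_div_liftGap hN hA
  simp only [cycSel_toArray_range (evolve N A)] at hm
  refine le_of_forall_exp_le (C := 2 * (2 * (2 * (N / liftGap A 1))) ^ (2 * N)) fun s hs => ?_
  have h1 := exp_le_coeff_trace (A := fun i : ℕ => A ((i + 1 : ℕ) : ZMod (2 * N)))
    (b := fun i : ℕ => lift A s ((i + 1 : ℕ) : ZMod (2 * N))) (s := s) (c := 1) le_rfl
    (fun i => by simp [lift]) hw
  have h2 := coeff_trace_le (A := fun i : ℕ => evolve N A (i : ZMod (2 * N)))
    (b := liftEvolve A s) (c := 2 * (N / liftGap A 1)) (by linarith) (by linarith : 0 ≤ s)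
    (fun i => (liftEvolve_pos hN hA hs i).le) (liftEvolve_le hN hA hs) hm
  rw [trace_lift_eq hN hA hs, one_pow, one_mul] at h1
  rw [List.length_range] at h2
  exact h1.trans h2

theorem lowerBound_evolve (hN : 1 ≤ N) (hA : IsState N A) {k : ℕ} {m w : ℝ}
    (hm : ∀ v, CycSel (toArray N A) k v → m ≤ v) (hw : CycSel (toArray N (evolve N A)) k w) :
    m ≤ w := by
  have hc := one_le_div_liftGap hN hA
  rw [cycSel_toArray_range (evolve N A)] at hw
  refine le_of_forall_exp_le
    (C := (2 * (N / liftGap A 1)) ^ (2 * N) * (2 * (2 * 1) ^ (2 * N))) fun s hs => ?_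
  have h1 := exp_le_coeff_trace (A := fun i : ℕ => evolve N A (i : ZMod (2 * N)))
    (b := liftEvolve A s) (c := 2 * (N / liftGap A 1)) (by linarith) (le_liftEvolve hN hA hs) hw
  have h2 := coeff_trace_le (A := fun i : ℕ => A ((i + 1 : ℕ) : ZMod (2 * N)))
    (b := fun i : ℕ => lift A s ((i + 1 : ℕ) : ZMod (2 * N))) (s := s) (c := 1) le_rfl
    (by linarith : 0 ≤ s) (fun i => (lift_pos _).le) (fun i => by simp [lift]) hm
  rw [trace_lift_eq hN hA hs, List.length_range] at h2
  rw [List.length_range] at h1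
  rw [mul_assoc]
  exact h1.trans (by gcongr)

/-- The quantities `H_k` are conserved. -/
theorem consH_evolve (hN : 1 ≤ N) (hA : IsState N A) {k : ℕ} (hk : k ≤ N) :
    consH N (evolve N A) k = consH N A k := by
  -- The elimination supplies attained minima before and after the step, as `consH_eq` requires.
  obtain ⟨n, hn⟩ := exists_highestWeight hN hA
  obtain ⟨n', hn'⟩ := exists_highestWeight hN (evolve_isState hN hA)
  have h := isLeast_elimRows hN hn hk
  have h' := isLeast_elimRows hN hn' hk
  rw [consH_eq hN h, consH_eq hN h']
  exact le_antisymm (evolve_lowerBound hN hA (fun v hv => h'.2 hv) h.1)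
    (lowerBound_evolve hN hA (fun v hv => h.2 hv) h'.1)

theorem laxRows_evolve (hN : 1 ≤ N) (hA : IsState N A) :
    laxRows N (evolve N A) = laxRows N A := by
  refine List.map_congr_left fun j hj => ?_
  have := List.mem_range.1 hj
  rw [consH_evolve hN hA (by omega), consH_evolve hN hA (by omega)]

theorem laxRows_evolve_iterate (hN : 1 ≤ N) (hA : IsState N A) (t : ℕ) :
    laxRows N ((evolve N)^[t] A) = laxRows N A := by
  induction t with
  | zero => rfl
  | succ t ih =>
    rw [Function.iterate_succ_apply', laxRows_evolve hN (evolve_iterate_isState hN hA t), ih]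

end TropToda

theorem mainTheorem1 (N : ℕ) (hN : 1 ≤ N) (A : ZMod (2 * N) → ℝ) (hA : TropToda.IsState N A) :
    -- a cyclic shift with the highest weight condition exists
    (∃ n : ZMod (2 * N), TropToda.HighestWeight N (TropToda.shift N n A)) ∧
    -- for every such shift, the areas are the conserved quantities and the diagrams coincide
    (∀ n : ZMod (2 * N), TropToda.HighestWeight N (TropToda.shift N n A) →
      (∀ k ∈ Finset.Icc 1 N,
        TropToda.areaBelow (TropToda.elimRows N (TropToda.shift N n A)) k
          = ENNReal.ofReal (TropToda.consH N A k)) ∧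
      TropToda.elimRows N (TropToda.shift N n A) = TropToda.laxRows N A) ∧
    -- row lengths are positive and weakly increase from bottom to top
    ((∀ l ∈ TropToda.laxRows N A, 0 < l) ∧ (TropToda.laxRows N A).Pairwise (· ≤ ·)) ∧
    -- the diagram is preserved under the time evolution
    (∀ t : ℕ, TropToda.IsState N ((TropToda.evolve N)^[t] A) ∧
      (∃ m : ZMod (2 * N),
        TropToda.HighestWeight N (TropToda.shift N m ((TropToda.evolve N)^[t] A))) ∧
      ∀ n m : ZMod (2 * N), TropToda.HighestWeight N (TropToda.shift N n A) →
        TropToda.HighestWeight N (TropToda.shift N m ((TropToda.evolve N)^[t] A)) →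
        TropToda.elimRows N (TropToda.shift N m ((TropToda.evolve N)^[t] A))
          = TropToda.elimRows N (TropToda.shift N n A)) := by
  have hpos : ∀ n : ZMod (2 * N), TropToda.HighestWeight N (TropToda.shift N n A) →
      ∀ r ∈ TropToda.elimRows N (TropToda.shift N n A), 0 < r := fun n hn r hr =>
    TropToda.elimRows_pos hN (fun j => hA.pos _) hn hr
  obtain ⟨n₀, hn₀⟩ := TropToda.exists_highestWeight hN hA
  refine ⟨⟨n₀, hn₀⟩, fun n hn => ⟨fun k hk => ?_, TropToda.elimRows_eq_laxRows hN hn⟩, ?_,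
    fun t => ?_⟩
  · have hk' := (Finset.mem_Icc.1 hk).2
    rw [TropToda.areaBelow_eq (fun r hr => (hpos n hn r hr).le)
      (by rwa [TropToda.elimRows_length hn]), TropToda.sum_take_elimRows hN hn hk']
  · rw [← TropToda.elimRows_eq_laxRows hN hn₀]
    exact ⟨hpos n₀ hn₀, TropToda.elimRows_pairwise hn₀⟩
  · have ht := TropToda.evolve_iterate_isState hN hA t
    refine ⟨ht, TropToda.exists_highestWeight hN ht, fun n m hn hm => ?_⟩
    rw [TropToda.elimRows_eq_laxRows hN hm, TropToda.elimRows_eq_laxRows hN hn,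
      TropToda.laxRows_evolve_iterate hN hA]
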